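/- **Setting.** Let $\mathcal X,\hat{\mathcal X}$ be measurable spaces, $\mu=P_X$ a probability measure on $\mathcal X$, and $d:\mathcal X\times\hat{\mathcal X}\to\mathbb R$ a measurable function (possibly negative). For an integer $n\ge1$ and $R,D\in\mathbb R$, an $(n,R,D)$ lossy source code consists of a measurable encoder $\mathcal E:\mathcal X^n\to\{1,2,\dots,2^{nR}\}$ and a decoder $\mathcal D:\{1,2,\dots,2^{nR}\}\to\hat{\mathcal X}^n$ such that, for $X_1,\dots,X_n$ i.i.d. with law $\mu$ and $\hat X^n=\mathcal D(\mathcal E(X^n))$, each $d(X_i,\hat X_i)$ is integrable and $$\frac1n\sum_{i=1}^n\mathbb E[d(X_i,\hat X_i)]\le D .$$ Here $\{1,2,\dots,2^{nR}\}$ is the set of integers $k$ with $1\le k\le 2^{nR}$ ($2^{nR}$ itself need not be an integer). Let $\mathcal F$ be the class of convex functions $f:[0,\infty)\to\mathbb R$ with $f(1)=0$ and $f(0)=f(0^+)$ that are twice differentiable on $(0,\infty)$ with $f''>0$ and $1/f''$ concave there. For probability measures $P,Q$ put $D_f(P\|Q)=\mathbb E_Q\left[f\left(\frac{dP}{dQ}\right)\right]\in(-\infty,\infty]$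 if $P\ll Q$, and $D_f(P\|Q)=\infty$ otherwise. For random variables $A,B$ define $$I_f^{CKZ}(A;B)=D_f(P_{AB}\|P_A\times P_B),\qquad I_f^{MBGYA}(A;B)=\inf_{Q_B}\left\{D_f(P_{AB}\|P_A\times Q_B)-D_f(P_B\|Q_B)\right\},$$ where the infimum is over probability measures $Q_B$ with $P_B\ll Q_B$ and $D_f(P_B\|Q_B)<\infty$. For a discrete random variable $A$ put $H_f^{CKZ}(A)=I_f^{CKZ}(A;A)$ and $H_f^{MBGYA}(A)=I_f^{MBGYA}(A;A)$. **Theorem.** For any $(n,R,D)$ lossy source code there is a channel (Markov kernel) $P_{\hat X|X}$ from $\mathcal X$ to $\hat{\mathcal X}$ such that, with $(X,\hat X)\sim P_XP_{\hat X|X}$: 1. $d(X,\hat X)$ is integrable and $\mathbb E[d(X,\hat X)]\le D$; 2. for every $f\in\mathcal F$, $$\frac1nH_f^{CKZ}(K)\ge I_f^{CKZ}(X;\hat X),\qquad \frac1nH_f^{MBGYA}(K)\ge I_f^{MBGYA}(X;\hat X),$$ where $K$ is uniform on $\{1,2,\dots,2^{nR}\}$, and moreover $$\frac1n\left\{f(0)\left(1-2^{-nR}\right)+2^{-nR}f\left(2^{nR}\right)\right\}\ge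 I_f^{CKZ}(X;\hat X).$$ If $2^{nR}$ is an integer, the last inequality is equivalent to the first one of part 2, since then $H_f^{CKZ}(K)=f(0)(1-2^{-nR})+2^{-nR}f(2^{nR})$. -/

import Mathlib

open MeasureTheory ProbabilityTheory

noncomputable section

namespace FInfo

/-- The class of convex functions on `[0, ∞)` that vanish at `1`, are right-continuous at `0`
(that is, `f 0 = f (0+)`), and have a strictly positive second derivative on `(0, ∞)` whose
reciprocal is concave there. Only the values of `f` on `[0, ∞)` are relevant. -/
structure ClassF (f : ℝ → ℝ) : Prop where
  convex : ConvexOn ℝ (Set.Ici 0) f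
  right_cont_zero : ContinuousWithinAt f (Set.Ici 0) 0
  map_one : f 1 = 0
  differentiable : ∀ t, 0 < t → DifferentiableAt ℝ f t
  differentiable_deriv : ∀ t, 0 < t → DifferentiableAt ℝ (deriv f) t
  deriv2_pos : ∀ t, 0 < t → 0 < deriv (deriv f) t
  concave_inv_deriv2 : ConcaveOn ℝ (Set.Ioi 0) (fun t => 1 / deriv (deriv f) t)

open Classical in
/-- The `f`-divergence `D_f(P‖Q) = E_Q [f (dP/dQ)]`. For convex `f` the negative part of
`f (dP/dQ)` is always `Q`-integrable, so non-integrability means that the expectation is `+∞`.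
The value is also `+∞` when `P` is not absolutely continuous with respect to `Q`. -/
def fDiv {α : Type*} [MeasurableSpace α] (f : ℝ → ℝ) (P Q : Measure α) : EReal :=
  if P ≪ Q ∧ Integrable (fun x => f (P.rnDeriv Q x).toReal) Q then
    ((∫ x, f (P.rnDeriv Q x).toReal ∂Q : ℝ) : EReal)
  else ⊤

/-- The mutual `f`-information `I_f^CKZ(A;B) = D_f(P_AB ‖ P_A × P_B)` of a pair with joint
law `P = P_AB`. -/
def mutualInfoCKZ {α β : Type*} [MeasurableSpace α] [MeasurableSpace β]
    (f : ℝ → ℝ) (P : Measure (α × β)) : EReal :=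
  fDiv f P (P.fst.prod P.snd)

/-- The mutual `f`-information `I_f^MBGYA(A;B)` of a pair with joint law `P = P_AB`: the infimum
of `D_f(P_AB ‖ P_A × Q_B) - D_f(P_B ‖ Q_B)` over the probability measures `Q_B` with `P_B ≪ Q_B`.
Only `Q_B` with `D_f(P_B ‖ Q_B) < ∞` count, as otherwise the difference is `∞ - ∞`. -/
def mutualInfoMBGYA {α β : Type*} [MeasurableSpace α] [MeasurableSpace β]
    (f : ℝ → ℝ) (P : Measure (α × β)) : EReal :=
  ⨅ Q : {Q : Measure β // IsProbabilityMeasure Q ∧ P.snd ≪ Q ∧ fDiv f P.snd Q ≠ ⊤},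
    (fDiv f P (P.fst.prod Q.1) - fDiv f P.snd Q.1)

/-- The `f`-entropy `H_f^CKZ(X) = I_f^CKZ(X;X)` of a random variable with law `P`. -/
def entropyCKZ {α : Type*} [MeasurableSpace α] (f : ℝ → ℝ) (P : Measure α) : EReal :=
  mutualInfoCKZ f (P.map fun x => (x, x))

/-- The `f`-entropy `H_f^MBGYA(X) = I_f^MBGYA(X;X)` of a random variable with law `P`. -/
def entropyMBGYA {α : Type*} [MeasurableSpace α] (f : ℝ → ℝ) (P : Measure α) : EReal :=
  mutualInfoMBGYA f (P.map fun x => (x, x))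

/-- The number of integers in `{1, 2, …, 2^(nR)}`. -/
def numMessages (n : ℕ) (R : ℝ) : ℕ := ⌊(2 : ℝ) ^ ((n : ℝ) * R)⌋₊

/-- An `(n, R, D)` lossy source code for the memoryless source with law `μ` and the distortion
function `d`. The message set `{1, …, 2^(nR)}` is modelled by `Fin (numMessages n R)`, and `X^n` is
the identity on `Fin n → X` under the product measure. -/
structure LossySourceCode {X Y : Type*} [MeasurableSpace X]
    (μ : Measure X) (d : X → Y → ℝ) (n : ℕ) (R D : ℝ) where
  enc : (Fin n → X) → Fin (numMessages n R)
  measurable_enc : Measurable enc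
  dec : Fin (numMessages n R) → (Fin n → Y)
  integrable_distortion : ∀ i : Fin n,
    Integrable (fun x : Fin n → X => d (x i) (dec (enc x) i)) (Measure.pi fun _ => μ)
  distortion_le :
    (1 / (n : ℝ)) * ∑ i : Fin n, ∫ x : Fin n → X, d (x i) (dec (enc x) i) ∂(Measure.pi fun _ => μ)
      ≤ D

/-- The law of a random variable that is uniform on a set of `m` elements. -/
def uniformLaw (m : ℕ) : Measure (Fin m) := uniformOn Set.univ

end FInfo

end

/-!
The channel is obtained by time sharing. Let `K` be the message of the i.i.d. vector `X₁, …, X_n`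
and `T` a uniform time index independent of the vector. The channel is the conditional law of the
reproduction `X̂_T = dec K T` given `X_T`; it is realized without disintegration by redrawing all
coordinates but the `T`-th (`timeSharedKernel`, `compProd_timeSharedKernel`). Since `X_T` has law
`μ`, the distortion is the average of the distortions of the code (`integral_timeShared`).

Data processing (`ClassF.fDiv_map_le`) reduces the information between `X_T` and `X̂_T` to that
between `X_T` and `(T, K)`, whose density with respect to the product of the marginals is
`P(K = k | X_i = x) / P(K = k)`. It remains to prove, for each message `k`, that
`∑ i, E f(P(K = k | X_i) / P(K = k)) ≤ E f(1{K = k} / P(K = k))`,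
because averaging the right-hand side over `K` gives the `f`-entropy of `K`.

This superadditivity is where the concavity of `1 / f''` enters. It makes the Bregman divergence
`B(a, b) = f a - f b - f' b (a - b)` jointly convex: second derivatives along segments have the form
`z² f''(s) = z² / (1 / f''(s))`, a jointly convex function of `(z, s)`. Integrating the resulting
tangent-plane inequality (`ClassF.bregman_tangent`) over a product of two spaces gives the
two-factor inequality
`E f(E[g | x]) + E f(E[g | y]) ≤ E f(g) + f(E g)` (`ClassF.integral_marginals_le`), and induction
over the coordinates gives `ClassF.sum_integral_marginals_le`.

Two consequences of the concavity of `1 / f''` handle the entropies. First, `f''` is nonincreasing,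
so `f'` is concave, so `φ t = (f t - f 0) / t` is concave; it is also nondecreasing. The entropy
`f 0 + ∑ k, p k * φ (1 / p k)` of a law on `m` points is therefore at most `f 0 + φ m`, its value at
the uniform law, and this is at most `f 0 + φ (2^(nR))`. Secondly, `t f''(t)` is nondecreasing, so
`q ↦ φ (1 / q) - φ (1 / (m q))` is convex; by Jensen's inequality the infimum that defines
`H_f^MBGYA` of a uniform variable is attained at the uniform law, where it equals `f 0 + φ m`. As
`I_f^MBGYA ≤ I_f^CKZ`, the same bound serves both notions of information.
-/

noncomputable section

namespace FInfo

/-! ### Analytic properties of the class of convex functions -/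

namespace ClassF

variable {f : ℝ → ℝ}

lemma hasDerivAt (h : ClassF f) {t : ℝ} (ht : 0 < t) : HasDerivAt f (deriv f t) t :=
  (h.differentiable t ht).hasDerivAt

lemma hasDerivAt_deriv (h : ClassF f) {t : ℝ} (ht : 0 < t) :
    HasDerivAt (deriv f) (deriv (deriv f) t) t :=
  (h.differentiable_deriv t ht).hasDerivAt

lemma continuousOn (h : ClassF f) : ContinuousOn f (Set.Ici 0) :=
  h.convex.continuousOn_Ici h.right_cont_zero

lemma continuous_comp_max (h : ClassF f) : Continuous fun t : ℝ => f (max t 0) :=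
  h.continuousOn.comp_continuous (by fun_prop) fun t => le_max_right t 0

lemma continuousOn_deriv (h : ClassF f) : ContinuousOn (deriv f) (Set.Ioi 0) :=
  fun t ht => (h.differentiable_deriv t ht).continuousAt.continuousWithinAt

/-- A positive concave function on `(0, ∞)` is nondecreasing, so `f''` is nonincreasing. -/
lemma deriv2_antitone (h : ClassF f) {s t : ℝ} (hs : 0 < s) (hst : s ≤ t) :
    deriv (deriv f) t ≤ deriv (deriv f) s := by
  rcases hst.eq_or_lt with rfl | hst
  · rfl
  have ht : 0 < t := hs.trans hst
  have hps := h.deriv2_pos s hs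
  have hpt := h.deriv2_pos t ht
  by_contra! hlt
  set L : ℝ → ℝ := fun t => 1 / deriv (deriv f) t with hL
  have hLlt : L t < L s := one_div_lt_one_div_of_lt hps hlt
  have hLs : 0 < L s := one_div_pos.2 hps
  have hLt : 0 < L t := one_div_pos.2 hpt
  -- Beyond `t`, concavity forces `L` to reach a nonpositive value at `T`.
  set T : ℝ := t + L t * (t - s) / (L s - L t) with hT
  have hd : 0 < L s - L t := by linarith
  have htT : t < T := by
    have : 0 < L t * (t - s) / (L s - L t) := by
      have : 0 < t - s := by linarith
      positivity
    linarith
  have hTpos : 0 < T := ht.trans htT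
  have key := h.concave_inv_deriv2.slope_anti_adjacent hs hTpos hst htT
  have hLT : 0 < L T := one_div_pos.2 (h.deriv2_pos T hTpos)
  change (L T - L t) / (T - t) ≤ (L t - L s) / (t - s) at key
  have h1 : T - t = L t * (t - s) / (L s - L t) := by rw [hT]; ring
  have h2 : 0 < t - s := by linarith
  rw [div_le_div_iff₀ (by linarith) h2, h1] at key
  have h3 : (L t - L s) * (L t * (t - s) / (L s - L t)) = - (L t * (t - s)) := by
    field_simp; ring
  rw [h3] at key
  nlinarith [mul_pos hLT h2]

/-- A positive concave function on `(0, ∞)`, divided by its argument, is nonincreasing, so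
`t f''(t)` is nondecreasing. -/
lemma mul_deriv2_mono (h : ClassF f) {s t : ℝ} (hs : 0 < s) (hst : s ≤ t) :
    s * deriv (deriv f) s ≤ t * deriv (deriv f) t := by
  rcases hst.eq_or_lt with rfl | hst
  · rfl
  have ht : 0 < t := hs.trans hst
  have hps := h.deriv2_pos s hs
  have hpt := h.deriv2_pos t ht
  set L : ℝ → ℝ := fun t => 1 / deriv (deriv f) t with hL
  have hLs : 0 < L s := one_div_pos.2 hps
  have hLt : 0 < L t := one_div_pos.2 hpt
  have key : ∀ ε ∈ Set.Ioo 0 s, (s - ε) * L t ≤ (t - ε) * L s := by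
    rintro ε ⟨hε, hεs⟩
    have h1 := h.concave_inv_deriv2.slope_anti_adjacent hε ht hεs hst
    change (L t - L s) / (t - s) ≤ (L s - L ε) / (s - ε) at h1
    have hLε : 0 < L ε := one_div_pos.2 (h.deriv2_pos ε hε)
    rw [div_le_div_iff₀ (by linarith) (by linarith)] at h1
    nlinarith [mul_pos hLε (sub_pos.2 hst)]
  have hlim : s * L t ≤ t * L s := by
    have c1 : ContinuousWithinAt (fun ε => (s - ε) * L t) (Set.Ioi 0) 0 := by
      fun_prop
    have c2 : ContinuousWithinAt (fun ε => (t - ε) * L s) (Set.Ioi 0) 0 := by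
      fun_prop
    have := le_of_tendsto_of_tendsto c1 c2
      (Filter.eventually_of_mem (Ioo_mem_nhdsGT hs) key)
    simpa using this
  rw [hL] at hlim
  simp only [mul_one_div] at hlim
  rwa [div_le_div_iff₀ hpt hps] at hlim

lemma concaveOn_deriv (h : ClassF f) : ConcaveOn ℝ (Set.Ioi 0) (deriv f) := by
  refine AntitoneOn.concaveOn_of_deriv (convex_Ioi 0) h.continuousOn_deriv ?_ ?_
  · rw [interior_Ioi]
    exact fun t ht => (h.differentiable_deriv t ht).differentiableWithinAt
  · rw [interior_Ioi]
    exact fun s hs t _ hst => h.deriv2_antitone hs hst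

lemma deriv_le_tangent (h : ClassF f) {s t : ℝ} (hs : 0 < s) (ht : 0 < t) :
    deriv f s ≤ deriv f t + deriv (deriv f) t * (s - t) := by
  rcases lt_trichotomy s t with hst | rfl | hst
  · have := h.concaveOn_deriv.le_slope_of_hasDerivAt hs ht hst (h.hasDerivAt_deriv ht)
    rw [slope_def_field, le_div_iff₀ (by linarith)] at this
    linarith
  · simp
  · have := h.concaveOn_deriv.slope_le_of_hasDerivAt ht hs hst (h.hasDerivAt_deriv ht)
    rw [slope_def_field, div_le_iff₀ (by linarith)] at this
    linarith

/-- The second-order Taylor polynomial of `f` at `t`, evaluated at `0`, is at most `f 0`: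
the third-order term has the favourable sign because `f'` is concave. -/
lemma taylor_le_map_zero (h : ClassF f) {t : ℝ} (ht : 0 < t) :
    f t - t * deriv f t + t ^ 2 * deriv (deriv f) t / 2 ≤ f 0 := by
  set g : ℝ → ℝ := fun s =>
    f s - f t - deriv f t * (s - t) - deriv (deriv f) t * (s - t) ^ 2 / 2 with hg
  have hanti : AntitoneOn g (Set.Icc 0 t) := by
    have hd : ∀ s ∈ interior (Set.Icc 0 t),
        HasDerivAt g (deriv f s - deriv f t - deriv (deriv f) t * (s - t)) s := by
      intro s hs
      rw [interior_Icc] at hs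
      have h1 := (((h.hasDerivAt hs.1).sub_const (f t)).sub
        (((hasDerivAt_id s).sub_const t).const_mul (deriv f t))).sub
        (((((hasDerivAt_id s).sub_const t).pow 2).const_mul (deriv (deriv f) t)).div_const 2)
      refine h1.congr_deriv ?_
      simp
      ring
    refine antitoneOn_of_deriv_nonpos (convex_Icc 0 t) ?_ ?_ ?_
    · have : ContinuousOn f (Set.Icc 0 t) := h.continuousOn.mono Set.Icc_subset_Ici_self
      rw [hg]
      fun_prop
    · exact fun s hs => (hd s hs).differentiableAt.differentiableWithinAt
    · intro s hs
      rw [(hd s hs).deriv]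
      rw [interior_Icc] at hs
      have := h.deriv_le_tangent hs.1 ht
      linarith
  have := hanti (Set.left_mem_Icc.2 ht.le) (Set.right_mem_Icc.2 ht.le) ht.le
  simp only [hg] at this
  nlinarith

lemma monotoneOn_slope_zero (h : ClassF f) :
    MonotoneOn (fun t => (f t - f 0) / t) (Set.Ioi 0) := by
  intro s hs t ht hst
  rcases hst.eq_or_lt with rfl | hst
  · rfl
  have hs' : 0 < s := hs
  have := h.convex.secant_mono (a := 0) (x := s) (y := t) (Set.mem_Ici.2 le_rfl)
    (Set.mem_Ici.2 hs'.le) (Set.mem_Ici.2 (hs'.trans hst).le) hs'.ne' (hs'.trans hst).ne' hst.le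
  simpa using this

lemma concaveOn_slope_zero (h : ClassF f) :
    ConcaveOn ℝ (Set.Ioi 0) (fun t => (f t - f 0) / t) := by
  have hd1 : ∀ t : ℝ, 0 < t → HasDerivAt (fun t => (f t - f 0) / t)
      ((t * deriv f t - (f t - f 0)) / t ^ 2) t := fun t ht => by
    refine (((h.hasDerivAt ht).sub_const (f 0)).div (hasDerivAt_id t) ht.ne').congr_deriv ?_
    simp; ring
  have hd2 : ∀ t : ℝ, 0 < t → HasDerivAt (fun t => (t * deriv f t - (f t - f 0)) / t ^ 2)
      ((t ^ 2 * deriv (deriv f) t - 2 * (t * deriv f t - (f t - f 0))) / t ^ 3) t := fun t ht => by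
    refine ((((hasDerivAt_id t).mul (h.hasDerivAt_deriv ht)).sub
      ((h.hasDerivAt ht).sub_const (f 0))).div ((hasDerivAt_id t).pow 2)
      (by simpa using ht.ne')).congr_deriv ?_
    simp
    field_simp
  refine concaveOn_of_hasDerivWithinAt2_nonpos (convex_Ioi 0)
    (fun t ht => (hd1 t ht).continuousAt.continuousWithinAt)
    (f' := fun t => (t * deriv f t - (f t - f 0)) / t ^ 2)
    (f'' := fun t => (t ^ 2 * deriv (deriv f) t - 2 * (t * deriv f t - (f t - f 0))) / t ^ 3)
    ?_ ?_ ?_ <;> rw [interior_Ioi] <;> intro t ht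
  · exact (hd1 t ht).hasDerivWithinAt
  · exact (hd2 t ht).hasDerivWithinAt
  · have ht' : 0 < t := ht
    have := h.taylor_le_map_zero ht
    exact div_nonpos_of_nonpos_of_nonneg (by linarith) (by positivity)

lemma hasDerivAt_perspective (h : ClassF f) {c q : ℝ} (hc : 0 < c) (hq : 0 < q) :
    HasDerivAt (fun q => q * f (1 / (c * q)))
      (f (1 / (c * q)) - 1 / (c * q) * deriv f (1 / (c * q))) q := by
  have h1 : HasDerivAt (fun q : ℝ => 1 / (c * q)) (-(1 / (c * q ^ 2))) q := by
    refine ((hasDerivAt_const q (1 : ℝ)).div ((hasDerivAt_id q).const_mul c)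
      (by simp; constructor <;> positivity)).congr_deriv ?_
    simp
    field_simp
  have hp : 0 < 1 / (c * q) := by positivity
  refine ((hasDerivAt_id q).mul ((h.hasDerivAt hp).comp q h1)).congr_deriv ?_
  simp
  field_simp
  ring

lemma hasDerivAt_perspective_deriv (h : ClassF f) {c q : ℝ} (hc : 0 < c) (hq : 0 < q) :
    HasDerivAt (fun q => f (1 / (c * q)) - 1 / (c * q) * deriv f (1 / (c * q)))
      (1 / (c ^ 2 * q ^ 3) * deriv (deriv f) (1 / (c * q))) q := by
  have h1 : HasDerivAt (fun q : ℝ => 1 / (c * q)) (-(1 / (c * q ^ 2))) q := by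
    refine ((hasDerivAt_const q (1 : ℝ)).div ((hasDerivAt_id q).const_mul c)
      (by simp; constructor <;> positivity)).congr_deriv ?_
    simp
    field_simp
  have hp : 0 < 1 / (c * q) := by positivity
  refine (((h.hasDerivAt hp).comp q h1).sub
    (h1.mul ((h.hasDerivAt_deriv hp).comp q h1))).congr_deriv ?_
  simp
  field_simp
  ring

/-- The difference of the perspectives of `f` at `1/q` and at `1/(mq)` is convex in `q`, because
`t f''(t)` is nondecreasing. -/
lemma convexOn_perspective_sub (h : ClassF f) {m : ℝ} (hm : 1 ≤ m) :
    ConvexOn ℝ (Set.Ioi 0) (fun q => q * f (1 / q) - m * (q * f (1 / (m * q)))) := by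
  have hm0 : 0 < m := by linarith
  have hd1 : ∀ q : ℝ, 0 < q → HasDerivAt (fun q => q * f (1 / q) - m * (q * f (1 / (m * q))))
      ((f (1 / q) - 1 / q * deriv f (1 / q)) -
        m * (f (1 / (m * q)) - 1 / (m * q) * deriv f (1 / (m * q)))) q := fun q hq => by
    have := h.hasDerivAt_perspective one_pos hq
    simp only [one_mul] at this
    exact this.sub ((h.hasDerivAt_perspective hm0 hq).const_mul m)
  have hd2 : ∀ q : ℝ, 0 < q → HasDerivAt (fun q => (f (1 / q) - 1 / q * deriv f (1 / q)) -
        m * (f (1 / (m * q)) - 1 / (m * q) * deriv f (1 / (m * q))))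
      (1 / q ^ 3 * deriv (deriv f) (1 / q) -
        m * (1 / (m ^ 2 * q ^ 3) * deriv (deriv f) (1 / (m * q)))) q := fun q hq => by
    have := h.hasDerivAt_perspective_deriv one_pos hq
    simp only [one_mul, one_pow] at this
    exact this.sub ((h.hasDerivAt_perspective_deriv hm0 hq).const_mul m)
  refine convexOn_of_hasDerivWithinAt2_nonneg (convex_Ioi 0)
    (fun q hq => (hd1 q hq).continuousAt.continuousWithinAt)
    (f' := fun q => (f (1 / q) - 1 / q * deriv f (1 / q)) -
        m * (f (1 / (m * q)) - 1 / (m * q) * deriv f (1 / (m * q))))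
    (f'' := fun q => 1 / q ^ 3 * deriv (deriv f) (1 / q) -
        m * (1 / (m ^ 2 * q ^ 3) * deriv (deriv f) (1 / (m * q))))
    ?_ ?_ ?_ <;> rw [interior_Ioi] <;> intro q hq
  · exact (hd1 q hq).hasDerivWithinAt
  · exact (hd2 q hq).hasDerivWithinAt
  · have hq' : 0 < q := hq
    have h1 : 1 / (m * q) ≤ 1 / q :=
      one_div_le_one_div_of_le hq' (by nlinarith)
    have h2 := h.mul_deriv2_mono (by positivity) h1
    have h3 : 1 / q ^ 3 * deriv (deriv f) (1 / q) -
        m * (1 / (m ^ 2 * q ^ 3) * deriv (deriv f) (1 / (m * q))) = 1 / q ^ 2 *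
        (1 / q * deriv (deriv f) (1 / q) - 1 / (m * q) * deriv (deriv f) (1 / (m * q))) := by
      field_simp
    rw [h3]
    exact mul_nonneg (by positivity) (by linarith)

/-- Joint convexity of `(z, s) ↦ z² f''(s)`: it is `z² / w` at the concave function `w = 1 / f''`. -/
lemma sq_mul_deriv2_convex (h : ClassF f) {z z' s s' τ : ℝ} (hs : 0 < s) (hs' : 0 < s')
    (h0 : 0 ≤ τ) (h1 : τ ≤ 1) :
    ((1 - τ) * z' + τ * z) ^ 2 * deriv (deriv f) ((1 - τ) * s' + τ * s) ≤
      (1 - τ) * (z' ^ 2 * deriv (deriv f) s') + τ * (z ^ 2 * deriv (deriv f) s) := by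
  have hm : 0 < (1 - τ) * s' + τ * s := by
    rcases h0.eq_or_lt with rfl | h0
    · simpa using hs'
    · have := mul_pos h0 hs
      have := mul_nonneg (sub_nonneg.2 h1) hs'.le
      linarith
  have hp := h.deriv2_pos _ hs
  have hp' := h.deriv2_pos _ hs'
  have hpm := h.deriv2_pos _ hm
  have hc := h.concave_inv_deriv2.2 (show s' ∈ Set.Ioi 0 from hs') (show s ∈ Set.Ioi 0 from hs)
    (sub_nonneg.2 h1) h0 (by ring)
  simp only [smul_eq_mul] at hc
  set u := deriv (deriv f) s
  set u' := deriv (deriv f) s'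
  set v := deriv (deriv f) ((1 - τ) * s' + τ * s)
  have hw : v * ((1 - τ) * (1 / u') + τ * (1 / u)) ≤ 1 := by
    rw [mul_comm, ← le_div_iff₀ hpm]; exact hc
  -- Cauchy-Schwarz in the form of Sedrakyan's lemma.
  have hcs : ((1 - τ) * z' + τ * z) ^ 2 ≤ ((1 - τ) * (1 / u') + τ * (1 / u)) *
      ((1 - τ) * (z' ^ 2 * u') + τ * (z ^ 2 * u)) := by
    have e : ((1 - τ) * (1 / u') + τ * (1 / u)) * ((1 - τ) * (z' ^ 2 * u') + τ * (z ^ 2 * u)) -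
        ((1 - τ) * z' + τ * z) ^ 2 = (1 - τ) * τ * (z' * u' - z * u) ^ 2 / (u * u') := by
      field_simp; ring
    have : 0 ≤ (1 - τ) * τ * (z' * u' - z * u) ^ 2 / (u * u') :=
      div_nonneg (mul_nonneg (mul_nonneg (sub_nonneg.2 h1) h0) (sq_nonneg _)) (by positivity)
    linarith
  have hR : 0 ≤ (1 - τ) * (z' ^ 2 * u') + τ * (z ^ 2 * u) :=
    add_nonneg (mul_nonneg (sub_nonneg.2 h1) (by positivity)) (by positivity)
  calc _ ≤ ((1 - τ) * (1 / u') + τ * (1 / u)) *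
      ((1 - τ) * (z' ^ 2 * u') + τ * (z ^ 2 * u)) * v := mul_le_mul_of_nonneg_right hcs hpm.le
    _ = (v * ((1 - τ) * (1 / u') + τ * (1 / u))) *
      ((1 - τ) * (z' ^ 2 * u') + τ * (z ^ 2 * u)) := by ring
    _ ≤ _ := mul_le_of_le_one_left hR hw

/-- Joint convexity of the Bregman divergence of `f`. Let `D θ` be the convexity gap of `f` at
the points that divide the segments from the second argument to the first in ratio `θ`. The gap of
the divergence is `D 1 - D 0 - D' 0`, and `D` is convex by `sq_mul_deriv2_convex`. -/
lemma bregman_convex (h : ClassF f) {a b a' b' τ : ℝ} (ha : 0 < a) (hb : 0 < b) (ha' : 0 < a')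
    (hb' : 0 < b') (h0 : 0 ≤ τ) (h1 : τ ≤ 1) :
    f ((1 - τ) * a' + τ * a) - f ((1 - τ) * b' + τ * b) - deriv f ((1 - τ) * b' + τ * b) *
        (((1 - τ) * a' + τ * a) - ((1 - τ) * b' + τ * b)) ≤
      (1 - τ) * (f a' - f b' - deriv f b' * (a' - b')) +
        τ * (f a - f b - deriv f b * (a - b)) := by
  have mix : ∀ {x y θ : ℝ}, 0 < x → 0 < y → 0 ≤ θ → θ ≤ 1 → 0 < x + θ * (y - x) := by
    intro x y θ hx hy h0 h1
    rcases h0.eq_or_lt with rfl | h0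
    · simpa using hx
    · have := mul_pos h0 hy
      have := mul_nonneg (sub_nonneg.2 h1) hx.le
      linarith
  set A := (1 - τ) * a' + τ * a with hA
  set C := (1 - τ) * b' + τ * b with hC
  have hApos : 0 < A := by have := mix ha' ha h0 h1; rw [hA]; linarith
  have hCpos : 0 < C := by have := mix hb' hb h0 h1; rw [hC]; linarith
  have d1 : ∀ x y θ : ℝ, 0 < x + θ * (y - x) →
      HasDerivAt (fun θ => f (x + θ * (y - x))) ((y - x) * deriv f (x + θ * (y - x))) θ := by
    intro x y θ hpos
    have hl : HasDerivAt (fun θ : ℝ => x + θ * (y - x)) (y - x) θ := by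
      simpa using ((hasDerivAt_id θ).mul_const (y - x)).const_add x
    exact ((h.hasDerivAt hpos).comp θ hl).congr_deriv (by ring)
  have d2 : ∀ x y θ : ℝ, 0 < x + θ * (y - x) →
      HasDerivAt (fun θ => (y - x) * deriv f (x + θ * (y - x)))
        ((y - x) ^ 2 * deriv (deriv f) (x + θ * (y - x))) θ := by
    intro x y θ hpos
    have hl : HasDerivAt (fun θ : ℝ => x + θ * (y - x)) (y - x) θ := by
      simpa using ((hasDerivAt_id θ).mul_const (y - x)).const_add x
    exact (((h.hasDerivAt_deriv hpos).comp θ hl).const_mul (y - x)).congr_deriv (by ring)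
  set D : ℝ → ℝ := fun θ => (1 - τ) * f (b' + θ * (a' - b')) + τ * f (b + θ * (a - b)) -
    f (C + θ * (A - C)) with hD
  set D' : ℝ → ℝ := fun θ => (1 - τ) * ((a' - b') * deriv f (b' + θ * (a' - b'))) +
    τ * ((a - b) * deriv f (b + θ * (a - b))) - (A - C) * deriv f (C + θ * (A - C)) with hD'
  have hd1 : ∀ θ ∈ Set.Icc (0 : ℝ) 1, HasDerivAt D (D' θ) θ := fun θ hθ =>
    (((d1 _ _ _ (mix hb' ha' hθ.1 hθ.2)).const_mul (1 - τ)).add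
      ((d1 _ _ _ (mix hb ha hθ.1 hθ.2)).const_mul τ)).sub (d1 _ _ _ (mix hCpos hApos hθ.1 hθ.2))
  have hconv : ConvexOn ℝ (Set.Icc 0 1) D := by
    refine convexOn_of_hasDerivWithinAt2_nonneg (convex_Icc 0 1)
      (fun θ hθ => (hd1 θ hθ).continuousAt.continuousWithinAt) (f' := D')
      (f'' := fun θ => (1 - τ) * ((a' - b') ^ 2 * deriv (deriv f) (b' + θ * (a' - b'))) +
        τ * ((a - b) ^ 2 * deriv (deriv f) (b + θ * (a - b))) -
        (A - C) ^ 2 * deriv (deriv f) (C + θ * (A - C))) ?_ ?_ ?_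
    · exact fun θ hθ => (hd1 θ (interior_subset hθ)).hasDerivWithinAt
    · intro θ hθ
      have hθ := interior_subset hθ
      exact ((((d2 _ _ _ (mix hb' ha' hθ.1 hθ.2)).const_mul (1 - τ)).add
        ((d2 _ _ _ (mix hb ha hθ.1 hθ.2)).const_mul τ)).sub
        (d2 _ _ _ (mix hCpos hApos hθ.1 hθ.2))).hasDerivWithinAt
    · intro θ hθ
      have hθ := interior_subset hθ
      have := h.sq_mul_deriv2_convex (z := a - b) (z' := a' - b') (mix hb ha hθ.1 hθ.2)
        (mix hb' ha' hθ.1 hθ.2) h0 h1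
      have e1 : (1 - τ) * (a' - b') + τ * (a - b) = A - C := by rw [hA, hC]; ring
      have e2 : (1 - τ) * (b' + θ * (a' - b')) + τ * (b + θ * (a - b)) = C + θ * (A - C) := by
        rw [hA, hC]; ring
      rw [e1, e2] at this
      linarith
  have := hconv.le_slope_of_hasDerivAt (Set.left_mem_Icc.2 zero_le_one)
    (Set.right_mem_Icc.2 zero_le_one) one_pos (hd1 0 (Set.left_mem_Icc.2 zero_le_one))
  simp only [slope_def_field, hD, hD'] at this
  simp only [zero_mul, add_zero, one_mul, sub_zero, div_one, add_sub_cancel] at this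
  linarith

/-- The tangent-plane inequality for the Bregman divergence of `f`, at the point `(a', b')`. -/
lemma bregman_tangent (h : ClassF f) {a b a' b' : ℝ} (ha : 0 < a) (hb : 0 < b) (ha' : 0 < a')
    (hb' : 0 < b') :
    f a' - f b' - deriv f b' * (a' - b') + (deriv f a' - deriv f b') * (a - a') -
        deriv (deriv f) b' * (a' - b') * (b - b') ≤ f a - f b - deriv f b * (a - b) := by
  set ψ : ℝ → ℝ := fun τ => f (a' + τ * (a - a')) - f (b' + τ * (b - b')) -
    deriv f (b' + τ * (b - b')) * ((a' + τ * (a - a')) - (b' + τ * (b - b'))) with hψ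
  have hl : ∀ x y : ℝ, HasDerivAt (fun τ : ℝ => x + τ * (y - x)) (y - x) 0 := fun x y => by
    simpa using ((hasDerivAt_id (0 : ℝ)).mul_const (y - x)).const_add x
  have hd : HasDerivAt ψ ((deriv f a' - deriv f b') * (a - a') -
        deriv (deriv f) b' * (a' - b') * (b - b')) 0 := by
    have ea : a' + 0 * (a - a') = a' := by ring
    have eb : b' + 0 * (b - b') = b' := by ring
    have k1 := HasDerivAt.comp (h₂ := f) 0 (by rw [ea]; exact h.hasDerivAt ha') (hl a' a)
    have k2 := HasDerivAt.comp (h₂ := f) 0 (by rw [eb]; exact h.hasDerivAt hb') (hl b' b)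
    have k3 := HasDerivAt.comp (h₂ := deriv f) 0
      (by rw [eb]; exact h.hasDerivAt_deriv hb') (hl b' b)
    refine ((k1.sub k2).sub (k3.mul ((hl a' a).sub (hl b' b)))).congr_deriv ?_
    simp only [Function.comp, ea, eb, Pi.sub_apply]
    ring
  -- Convexity of the Bregman divergence bounds the difference quotients of `ψ` by `ψ 1 - ψ 0`.
  have hlim := hd.tendsto_slope_zero_right
  have hle : ∀ᶠ τ : ℝ in nhdsWithin 0 (Set.Ioi 0), τ⁻¹ • (ψ (0 + τ) - ψ 0) ≤ ψ 1 - ψ 0 := by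
    filter_upwards [Ioo_mem_nhdsGT one_pos] with τ hτ
    have hb := h.bregman_convex ha hb ha' hb' hτ.1.le hτ.2.le
    have e1 : (1 - τ) * a' + τ * a = a' + τ * (a - a') := by ring
    have e2 : (1 - τ) * b' + τ * b = b' + τ * (b - b') := by ring
    rw [e1, e2] at hb
    rw [smul_eq_mul, inv_mul_le_iff₀ hτ.1, zero_add]
    simp only [hψ, zero_mul, add_zero, one_mul, add_sub_cancel]
    linarith
  have := le_of_tendsto hlim hle
  simp only [hψ, zero_mul, add_zero, one_mul, add_sub_cancel] at this
  linarith

end ClassF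

/-! ### Subadditivity over independent coordinates -/

/-- A measurable real function that is bounded everywhere, hence integrable with respect to every
finite measure; the class is closed under the operations used below. -/
def BddMeas {α : Type*} [MeasurableSpace α] (w : α → ℝ) : Prop :=
  Measurable w ∧ ∃ C, ∀ x, |w x| ≤ C

namespace BddMeas

variable {α β : Type*} [MeasurableSpace α] [MeasurableSpace β]

lemma const (c : ℝ) : BddMeas (fun _ : α => c) := ⟨measurable_const, |c|, fun _ => le_rfl⟩

lemma sub {v w : α → ℝ} (hv : BddMeas v) (hw : BddMeas w) : BddMeas fun x => v x - w x := by
  obtain ⟨mv, C, hC⟩ := hv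
  obtain ⟨mw, C', hC'⟩ := hw
  exact ⟨mv.sub mw, C + C', fun x => (abs_sub _ _).trans (add_le_add (hC x) (hC' x))⟩

lemma mul {v w : α → ℝ} (hv : BddMeas v) (hw : BddMeas w) : BddMeas fun x => v x * w x := by
  obtain ⟨mv, C, hC⟩ := hv
  obtain ⟨mw, C', hC'⟩ := hw
  refine ⟨mv.mul mw, C * C', fun x => ?_⟩
  rw [abs_mul]
  exact mul_le_mul (hC x) (hC' x) (abs_nonneg _) ((abs_nonneg _).trans (hC x))

lemma integrable {w : α → ℝ} (hw : BddMeas w) (μ : Measure α) [IsFiniteMeasure μ] :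
    Integrable w μ := by
  obtain ⟨mw, C, hC⟩ := hw
  exact Integrable.of_bound mw.aestronglyMeasurable C (ae_of_all _ hC)

lemma comp {w : β → ℝ} (hw : BddMeas w) {g : α → β} (hg : Measurable g) :
    BddMeas fun x => w (g x) :=
  ⟨hw.1.comp hg, hw.2.imp fun _ hC x => hC (g x)⟩

/-- Values in a compact interval on which `F` is continuous. -/
lemma of_continuousOn {F : ℝ → ℝ} {l u : ℝ} (hF : ContinuousOn F (Set.Icc l u)) {w : α → ℝ}
    (hw : Measurable w) (hmem : ∀ x, w x ∈ Set.Icc l u) : BddMeas fun x => F (w x) := by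
  rcases isEmpty_or_nonempty α with hα | ⟨⟨x₀⟩⟩
  · exact ⟨measurable_of_empty _, 0, fun x => isEmptyElim x⟩
  have hlu : l ≤ u := (hmem x₀).1.trans (hmem x₀).2
  constructor
  · have hc : Continuous fun t => F (max l (min u t)) :=
      hF.comp_continuous (by fun_prop) fun t => ⟨le_max_left _ _, max_le hlu (min_le_left _ _)⟩
    have : (fun x => F (w x)) = fun x => F (max l (min u (w x))) := by
      funext x
      rw [min_eq_right (hmem x).2, max_eq_right (hmem x).1]
    rw [this]
    exact hc.measurable.comp hw
  · obtain ⟨C, hC⟩ := isCompact_Icc.exists_bound_of_continuousOn hF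
    exact ⟨C, fun x => hC _ (hmem x)⟩

end BddMeas

lemma integral_mem_Icc {α : Type*} [MeasurableSpace α] (μ : Measure α) [IsProbabilityMeasure μ]
    {w : α → ℝ} (hw : Measurable w) {l u : ℝ} (hmem : ∀ x, w x ∈ Set.Icc l u) :
    ∫ x, w x ∂μ ∈ Set.Icc l u := by
  have hi : Integrable w μ := (BddMeas.of_continuousOn continuousOn_id hw hmem).integrable μ
  constructor
  · simpa using integral_mono (integrable_const l) hi fun x => (hmem x).1
  · simpa using integral_mono hi (integrable_const u) fun x => (hmem x).2

section Tensorization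

variable {α β : Type*} [MeasurableSpace α] [MeasurableSpace β]

/-- Two-factor subadditivity, for a function bounded away from `0`. Integrating the tangent-plane
inequality of the Bregman divergence at `(∫ g(·, y) dμ, ∫ g)` makes all first-order terms vanish. -/
lemma ClassF.integral_marginals_le {f : ℝ → ℝ} (h : ClassF f) (μ : Measure α)
    [IsProbabilityMeasure μ] (ν : Measure β) [IsProbabilityMeasure ν] {g : α × β → ℝ}
    (hg : Measurable g) {l u : ℝ} (hl : 0 < l) (hmem : ∀ p, g p ∈ Set.Icc l u) :
    ∫ x, f (∫ y, g (x, y) ∂ν) ∂μ + ∫ y, f (∫ x, g (x, y) ∂μ) ∂ν ≤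
      ∫ p, f (g p) ∂(μ.prod ν) + f (∫ p, g p ∂(μ.prod ν)) := by
  have hpos : ∀ {t}, t ∈ Set.Icc l u → 0 < t := fun ht => hl.trans_le ht.1
  have hfc : ContinuousOn f (Set.Icc l u) := h.continuousOn.mono fun t ht => (hpos ht).le
  have hf'c : ContinuousOn (deriv f) (Set.Icc l u) := h.continuousOn_deriv.mono fun t ht => hpos ht
  set U : α → ℝ := fun x => ∫ y, g (x, y) ∂ν with hU
  set V : β → ℝ := fun y => ∫ x, g (x, y) ∂μ with hV
  set c := ∫ p, g p ∂(μ.prod ν) with hc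
  have hUm : Measurable U := hg.stronglyMeasurable.integral_prod_right'.measurable
  have hVm : Measurable V := hg.stronglyMeasurable.integral_prod_left'.measurable
  have hUmem : ∀ x, U x ∈ Set.Icc l u := fun x =>
    integral_mem_Icc ν (hg.comp measurable_prodMk_left) fun y => hmem _
  have hVmem : ∀ y, V y ∈ Set.Icc l u := fun y =>
    integral_mem_Icc μ (hg.comp measurable_prodMk_right) fun y => hmem _
  have hcmem : c ∈ Set.Icc l u := integral_mem_Icc _ hg hmem
  have bg : BddMeas g := BddMeas.of_continuousOn continuousOn_id hg hmem
  have bU : BddMeas U := BddMeas.of_continuousOn continuousOn_id hUm hUmem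
  have bV : BddMeas V := BddMeas.of_continuousOn continuousOn_id hVm hVmem
  have bfg : BddMeas fun p => f (g p) := BddMeas.of_continuousOn hfc hg hmem
  have bfU : BddMeas fun x => f (U x) := BddMeas.of_continuousOn hfc hUm hUmem
  have bfV : BddMeas fun y => f (V y) := BddMeas.of_continuousOn hfc hVm hVmem
  have bdU : BddMeas fun x => deriv f (U x) := BddMeas.of_continuousOn hf'c hUm hUmem
  have bdV : BddMeas fun y => deriv f (V y) := BddMeas.of_continuousOn hf'c hVm hVmem
  -- The five terms of the tangent-plane inequality, as functions on the product.
  have b1 : BddMeas fun p : α × β => deriv f (U p.1) * (g p - U p.1) :=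
    (bdU.comp measurable_fst).mul (bg.sub (bU.comp measurable_fst))
  have b2 : BddMeas fun p : α × β => deriv f c * (V p.2 - c) :=
    (BddMeas.const _).mul ((bV.comp measurable_snd).sub (BddMeas.const _))
  have b3 : BddMeas fun p : α × β => (deriv f (V p.2) - deriv f c) * (g p - V p.2) :=
    ((bdV.comp measurable_snd).sub (BddMeas.const _)).mul (bg.sub (bV.comp measurable_snd))
  have b4 : BddMeas fun p : α × β => deriv (deriv f) c * (V p.2 - c) * (U p.1 - c) :=
    ((BddMeas.const _).mul ((bV.comp measurable_snd).sub (BddMeas.const _))).mul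
      ((bU.comp measurable_fst).sub (BddMeas.const _))
  have i1 : ∫ p, deriv f (U p.1) * (g p - U p.1) ∂(μ.prod ν) = 0 := by
    rw [integral_prod _ (b1.integrable _)]
    refine integral_eq_zero_of_ae (ae_of_all _ fun x => ?_)
    simp only [integral_const_mul, Pi.zero_apply]
    rw [integral_sub ((bg.comp measurable_prodMk_left).integrable _) (integrable_const _)]
    simp [hU]
  have i3 : ∫ p, (deriv f (V p.2) - deriv f c) * (g p - V p.2) ∂(μ.prod ν) = 0 := by
    rw [integral_prod_symm _ (b3.integrable _)]
    refine integral_eq_zero_of_ae (ae_of_all _ fun y => ?_)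
    simp only [integral_const_mul, Pi.zero_apply]
    rw [integral_sub ((bg.comp measurable_prodMk_right).integrable _) (integrable_const _)]
    simp [hV]
  have iV : ∫ y, (V y - c) ∂ν = 0 := by
    rw [integral_sub (bV.integrable _) (integrable_const _), hc,
      integral_prod_symm _ (bg.integrable _)]
    simp [hV]
  have i2 : ∫ p : α × β, deriv f c * (V p.2 - c) ∂(μ.prod ν) = 0 := by
    rw [integral_const_mul, integral_fun_snd (μ := μ) (ν := ν) (fun y => V y - c), iV]
    simp
  have i4 : ∫ p : α × β, deriv (deriv f) c * (V p.2 - c) * (U p.1 - c) ∂(μ.prod ν) = 0 := by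
    rw [integral_prod _ (b4.integrable _)]
    refine integral_eq_zero_of_ae (ae_of_all _ fun x => ?_)
    simp only [integral_mul_const, integral_const_mul, iV]
    simp
  have iU : ∫ p : α × β, f (U p.1) ∂(μ.prod ν) = ∫ x, f (U x) ∂μ := by
    rw [integral_fun_fst (μ := μ) (ν := ν) (fun x => f (U x))]
    simp
  have iV' : ∫ p : α × β, f (V p.2) ∂(μ.prod ν) = ∫ y, f (V y) ∂ν := by
    rw [integral_fun_snd (μ := μ) (ν := ν) (fun y => f (V y))]
    simp
  have key := integral_mono (μ := μ.prod ν)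
    (((((bfV.comp measurable_snd).sub (BddMeas.const (f c))).sub b2).integrable (μ.prod ν)).add
      (b3.integrable _) |>.sub (b4.integrable _))
    (((bfg.sub (bfU.comp measurable_fst)).sub b1).integrable (μ.prod ν))
    (fun p => h.bregman_tangent (hpos (hmem p)) (hpos (hUmem p.1)) (hpos (hVmem p.2)) (hpos hcmem))
  have e1 : ∫ p : α × β, (f (g p) - f (U p.1) - deriv f (U p.1) * (g p - U p.1)) ∂(μ.prod ν) =
      ∫ p, f (g p) ∂(μ.prod ν) - ∫ x, f (U x) ∂μ := by
    rw [integral_sub ((bfg.sub (bfU.comp measurable_fst)).integrable _) (b1.integrable _),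
      integral_sub (bfg.integrable _) ((bfU.comp measurable_fst).integrable _), i1, iU, sub_zero]
  have e2 : ∫ p : α × β, (f (V p.2) - f c - deriv f c * (V p.2 - c) +
      (deriv f (V p.2) - deriv f c) * (g p - V p.2) -
      deriv (deriv f) c * (V p.2 - c) * (U p.1 - c)) ∂(μ.prod ν) =
      ∫ y, f (V y) ∂ν - f c := by
    rw [integral_sub _ (b4.integrable _), integral_add _ (b3.integrable _),
      integral_sub _ (b2.integrable _),
      integral_sub ((bfV.comp measurable_snd).integrable _) (integrable_const _), i2, i3, i4, iV']
    · simp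
    · exact ((bfV.comp measurable_snd).sub (BddMeas.const (f c))).integrable _
    · exact (((bfV.comp measurable_snd).sub (BddMeas.const (f c))).sub b2).integrable _
    · exact ((((bfV.comp measurable_snd).sub (BddMeas.const (f c))).sub b2).integrable _).add
        (b3.integrable _)
  have key' : ∫ p : α × β, (f (V p.2) - f c - deriv f c * (V p.2 - c) +
      (deriv f (V p.2) - deriv f c) * (g p - V p.2) -
      deriv (deriv f) c * (V p.2 - c) * (U p.1 - c)) ∂(μ.prod ν) ≤
      ∫ p : α × β, (f (g p) - f (U p.1) - deriv f (U p.1) * (g p - U p.1)) ∂(μ.prod ν) := key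
  rw [e1, e2] at key'
  linarith

variable {X : Type*} [MeasurableSpace X]

lemma measurable_finCons (n : ℕ) :
    Measurable fun p : X × (Fin n → X) => (Fin.cons p.1 p.2 : Fin (n + 1) → X) :=
  measurable_pi_iff.2 fun j => by
    refine Fin.cases ?_ (fun j => ?_) j
    · simpa using measurable_fst
    · simp only [Fin.cons_succ]
      exact (measurable_pi_apply j).comp measurable_snd

lemma integral_pi_succ (μ : Measure X) [SigmaFinite μ] {n : ℕ} (G : (Fin (n + 1) → X) → ℝ) :
    ∫ z, G z ∂(Measure.pi fun _ => μ) =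
      ∫ p : X × (Fin n → X), G (Fin.cons p.1 p.2) ∂(μ.prod (Measure.pi fun _ => μ)) := by
  have h := (measurePreserving_piFinSuccAbove (fun _ : Fin (n + 1) => μ) 0).symm.integral_comp' G
  rw [← h]
  refine integral_congr_ae (ae_of_all _ fun p => ?_)
  simp [MeasurableEquiv.piFinSuccAbove_symm_apply, Fin.insertNthEquiv]

lemma measurable_update_prod {n : ℕ} (i : Fin n) :
    Measurable fun p : X × (Fin n → X) => Function.update p.2 i p.1 := by
  refine measurable_pi_iff.2 fun j => ?_
  by_cases hj : j = i
  · subst hj; simpa using measurable_fst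
  · simp only [Function.update_of_ne hj]
    exact (measurable_pi_apply j).comp measurable_snd

lemma measurable_integral_update (μ : Measure X) [IsProbabilityMeasure μ] {n : ℕ}
    {g : (Fin n → X) → ℝ} (hg : Measurable g) (i : Fin n) :
    Measurable fun x => ∫ z, g (Function.update z i x) ∂(Measure.pi fun _ => μ) :=
  ((hg.comp (measurable_update_prod i)).stronglyMeasurable.integral_prod_right').measurable

/-- Subadditivity over `n` independent coordinates, for a function bounded away from `0`. -/
lemma ClassF.sum_integral_marginals_le_of_pos {f : ℝ → ℝ} (h : ClassF f) (μ : Measure X)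
    [IsProbabilityMeasure μ] {l u : ℝ} (hl : 0 < l) :
    ∀ {n : ℕ} {g : (Fin n → X) → ℝ}, Measurable g → (∀ x, g x ∈ Set.Icc l u) →
      ∑ i, ∫ x, f (∫ z, g (Function.update z i x) ∂(Measure.pi fun _ => μ)) ∂μ ≤
        ∫ z, f (g z) ∂(Measure.pi fun _ => μ) +
          ((n : ℝ) - 1) * f (∫ z, g z ∂(Measure.pi fun _ => μ)) := by
  intro n
  induction n with
  | zero =>
    intro g hg hmem
    have : ∀ z, g z = g default := fun z => congrArg g (Subsingleton.elim _ _)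
    have e1 : ∫ z, g z ∂(Measure.pi fun _ : Fin 0 => μ) = g default := by simp [this]
    have e2 : ∫ z, f (g z) ∂(Measure.pi fun _ : Fin 0 => μ) = f (g default) := by simp [this]
    rw [e1, e2]
    simp
  | succ n ih =>
    intro g hg hmem
    set P : Measure (Fin n → X) := Measure.pi fun _ => μ with hP
    set g' : X × (Fin n → X) → ℝ := fun p => g (Fin.cons p.1 p.2) with hg'
    have hg'm : Measurable g' := hg.comp (measurable_finCons n)
    have hg'mem : ∀ p, g' p ∈ Set.Icc l u := fun p => hmem _
    have bg' : BddMeas g' := BddMeas.of_continuousOn continuousOn_id hg'm hg'mem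
    set v : (Fin n → X) → ℝ := fun z => ∫ x, g' (x, z) ∂μ with hv
    have hvm : Measurable v := hg'm.stronglyMeasurable.integral_prod_left'.measurable
    have hvmem : ∀ z, v z ∈ Set.Icc l u := fun z =>
      integral_mem_Icc μ (hg'm.comp measurable_prodMk_right) fun _ => hg'mem _
    have h2 := h.integral_marginals_le μ P hg'm hl hg'mem
    have hi := ih hvm hvmem
    have e0 : ∀ x, ∫ z, g (Function.update z 0 x) ∂(Measure.pi fun _ : Fin (n + 1) => μ) =
        ∫ z, g' (x, z) ∂P := fun x => by
      rw [integral_pi_succ]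
      simp only [Fin.update_cons_zero]
      rw [integral_fun_snd (μ := μ) (ν := P) (fun z => g (Fin.cons x z : Fin (n + 1) → X))]
      simp [hg']
    have es : ∀ (i : Fin n) x,
        ∫ z, g (Function.update z i.succ x) ∂(Measure.pi fun _ : Fin (n + 1) => μ) =
        ∫ z, v (Function.update z i x) ∂P := fun i x => by
      rw [integral_pi_succ, integral_prod_symm]
      · simp only [← Fin.cons_update]
        rfl
      · simp only [← Fin.cons_update]
        exact (bg'.comp (g := fun p : X × (Fin n → X) => (p.1, Function.update p.2 i x))
          (measurable_fst.prodMk ((measurable_update' (a := i)).comp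
            (measurable_snd.prodMk measurable_const)))).integrable _
    have ec : ∫ z, v z ∂P = ∫ p, g' p ∂(μ.prod P) :=
      (integral_prod_symm _ (bg'.integrable _)).symm
    rw [Fin.sum_univ_succ]
    simp only [e0, es]
    rw [integral_pi_succ, integral_pi_succ μ g]
    push_cast
    rw [ec] at hi
    linarith

lemma tendsto_integral_comp_add {F : ℝ → ℝ} (hF : Continuous F) (ν : Measure α)
    [IsFiniteMeasure ν] {w : α → ℝ} (hw : BddMeas w) :
    Filter.Tendsto (fun δ : ℝ => ∫ x, F (w x + δ) ∂ν) (nhdsWithin 0 (Set.Ioi 0))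
      (nhds (∫ x, F (w x) ∂ν)) := by
  obtain ⟨hm, C, hC⟩ := hw
  obtain ⟨K, hK⟩ := (isCompact_Icc (a := -C - 1) (b := C + 1)).exists_bound_of_continuousOn
    hF.continuousOn
  refine tendsto_integral_filter_of_dominated_convergence (fun _ => K) ?_ ?_
    (integrable_const K) ?_
  · exact Filter.Eventually.of_forall fun δ =>
      (hF.measurable.comp (hm.add_const δ)).aestronglyMeasurable
  · filter_upwards [Ioo_mem_nhdsGT (one_pos : (0 : ℝ) < 1)] with δ hδ
    refine ae_of_all _ fun x => hK _ ?_
    have := abs_le.1 (hC x)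
    constructor <;> linarith [hδ.1, hδ.2]
  · refine ae_of_all _ fun x => ?_
    have : Continuous fun δ => F (w x + δ) := hF.comp (by fun_prop)
    simpa using (this.tendsto 0).mono_left nhdsWithin_le_nhds

/-- Subadditivity over `n` independent coordinates: superadditivity of the `f`-divergence relative
to a product measure. -/
lemma ClassF.sum_integral_marginals_le {f : ℝ → ℝ} (h : ClassF f) (μ : Measure X)
    [IsProbabilityMeasure μ] {u : ℝ} {n : ℕ} {g : (Fin n → X) → ℝ} (hg : Measurable g)
    (hmem : ∀ x, g x ∈ Set.Icc 0 u) :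
    ∑ i, ∫ x, f (∫ z, g (Function.update z i x) ∂(Measure.pi fun _ => μ)) ∂μ ≤
      ∫ z, f (g z) ∂(Measure.pi fun _ => μ) +
        ((n : ℝ) - 1) * f (∫ z, g z ∂(Measure.pi fun _ => μ)) := by
  set P : Measure (Fin n → X) := Measure.pi fun _ => μ with hP
  set F : ℝ → ℝ := fun t => f (max t 0) with hF
  have hFc : Continuous F := h.continuous_comp_max
  have hFf : ∀ {t}, 0 ≤ t → F t = f t := fun ht => by simp [hF, max_eq_left ht]
  set E : Fin n → X → ℝ := fun i x => ∫ z, g (Function.update z i x) ∂P with hE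
  have hEm : ∀ i, Measurable (E i) := fun i => measurable_integral_update μ hg i
  have hgi : ∀ i x, Measurable fun z : Fin n → X => g (Function.update z i x) := fun i x =>
    hg.comp ((measurable_update_prod i).comp measurable_prodMk_left)
  have hEmem : ∀ i x, E i x ∈ Set.Icc 0 u := fun i x => integral_mem_Icc P (hgi i x) fun _ => hmem _
  have hcmem := integral_mem_Icc P hg hmem
  have bg : BddMeas g := BddMeas.of_continuousOn continuousOn_id hg hmem
  have bE : ∀ i, BddMeas (E i) := fun i =>
    BddMeas.of_continuousOn continuousOn_id (hEm i) (hEmem i)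
  have bgi : ∀ i x, BddMeas fun z : Fin n → X => g (Function.update z i x) := fun i x =>
    BddMeas.of_continuousOn continuousOn_id (hgi i x) fun _ => hmem _
  -- Apply the bounded-below case to `g + δ` and let `δ → 0`, since `f'` may be unbounded at `0`.
  have key : ∀ δ : ℝ, 0 < δ → ∑ i, ∫ x, F (E i x + δ) ∂μ ≤
      ∫ z, F (g z + δ) ∂P + ((n : ℝ) - 1) * F ((∫ z, g z ∂P) + δ) := by
    intro δ hδ
    have := h.sum_integral_marginals_le_of_pos μ (l := δ) (u := u + δ) hδ (g := fun z => g z + δ)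
      (hg.add_const δ) fun x => ⟨by linarith [(hmem x).1], by linarith [(hmem x).2]⟩
    have e1 : ∀ i x, ∫ z, (g (Function.update z i x) + δ) ∂P = E i x + δ := fun i x => by
      rw [integral_add ((bgi i x).integrable _) (integrable_const _)]
      simp [hE]
    have e2 : ∫ z, (g z + δ) ∂P = (∫ z, g z ∂P) + δ := by
      rw [integral_add (bg.integrable _) (integrable_const _)]
      simp
    simp only [← hP, e1, e2] at this
    rw [hFf (by linarith [hcmem.1])]
    simp only [hFf (add_nonneg (hEmem _ _).1 hδ.le), hFf (add_nonneg (hmem _).1 hδ.le)]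
    exact this
  have hlim1 : Filter.Tendsto (fun δ => ∑ i, ∫ x, F (E i x + δ) ∂μ) (nhdsWithin 0 (Set.Ioi 0))
      (nhds (∑ i, ∫ x, F (E i x) ∂μ)) :=
    tendsto_finsetSum _ fun i _ => tendsto_integral_comp_add hFc μ (bE i)
  have hlim2 : Filter.Tendsto (fun δ => ∫ z, F (g z + δ) ∂P + ((n : ℝ) - 1) *
      F ((∫ z, g z ∂P) + δ)) (nhdsWithin 0 (Set.Ioi 0))
      (nhds (∫ z, F (g z) ∂P + ((n : ℝ) - 1) * F (∫ z, g z ∂P))) := by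
    refine (tendsto_integral_comp_add hFc P bg).add (Filter.Tendsto.const_mul _ ?_)
    have : Continuous fun δ => F ((∫ z, g z ∂P) + δ) := hFc.comp (by fun_prop)
    simpa using (this.tendsto 0).mono_left nhdsWithin_le_nhds
  have := le_of_tendsto_of_tendsto hlim1 hlim2
    (Filter.eventually_of_mem self_mem_nhdsWithin fun δ hδ => key δ hδ)
  rw [hFf hcmem.1] at this
  simpa only [hFf (hEmem _ _).1, hFf (hmem _).1] using this

end Tensorization

/-! ### `f`-divergences and `f`-entropies of uniform variables -/

section Divergence

variable {α β : Type*} [MeasurableSpace α] [MeasurableSpace β] {f : ℝ → ℝ}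

lemma ClassF.fDiv_withDensity (h : ClassF f) (Q : Measure α) [IsFiniteMeasure Q] {r : α → ℝ}
    (hr : Measurable r) {u : ℝ} (hmem : ∀ x, r x ∈ Set.Icc 0 u) :
    fDiv f (Q.withDensity fun x => ENNReal.ofReal (r x)) Q = ((∫ x, f (r x) ∂Q : ℝ) : EReal) := by
  have hae : (fun x => f ((Q.withDensity fun x => ENNReal.ofReal (r x)).rnDeriv Q x).toReal) =ᵐ[Q]
      fun x => f (r x) := by
    filter_upwards [Q.rnDeriv_withDensity hr.ennreal_ofReal] with x hx
    rw [hx, ENNReal.toReal_ofReal (hmem x).1]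
  have hint : Integrable (fun x => f (r x)) Q :=
    (BddMeas.of_continuousOn (h.continuousOn.mono Set.Icc_subset_Ici_self) hr hmem).integrable Q
  rw [fDiv, if_pos ⟨withDensity_absolutelyContinuous _ _, (integrable_congr hae).2 hint⟩,
    integral_congr_ae hae]

/-- The data processing inequality for a deterministic map. -/
lemma ClassF.fDiv_map_le (h : ClassF f) (P Q : Measure α) [IsFiniteMeasure P] [IsFiniteMeasure Q]
    {g : α → β} (hg : Measurable g) : fDiv f (P.map g) (Q.map g) ≤ fDiv f P Q := by
  by_cases hPQ : P ≪ Q ∧ Integrable (fun x => f (P.rnDeriv Q x).toReal) Q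
  swap
  · rw [fDiv, fDiv, if_neg hPQ]
    exact le_top
  obtain ⟨hac, hint⟩ := hPQ
  -- Only the values of `f` on `[0, ∞)` matter; `F` is a continuous function that agrees with `f`
  -- there.
  set F : ℝ → ℝ := fun t => f (max t 0) with hF
  have hFf : ∀ x : ENNReal, F x.toReal = f x.toReal := fun x => by
    simp [hF]
  have hFm : StronglyMeasurable F := h.continuous_comp_max.stronglyMeasurable
  have hFeq : Set.EqOn f F (Set.Ici 0) := fun t ht => by
    simp [hF, max_eq_left (Set.mem_Ici.1 ht)]
  have hFconv : ConvexOn ℝ (Set.Ici 0) F := h.convex.congr hFeq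
  have hF0 : ContinuousWithinAt F (Set.Ici 0) 0 := h.continuous_comp_max.continuousWithinAt
  have hintF : Integrable (fun x => F (P.rnDeriv Q x).toReal) Q := by simpa only [hFf] using hint
  have hle := hFconv.comp_rnDeriv_map_le hac hg hFm hF0 hintF
  have hmap := hFconv.integrable_comp_rnDeriv_map hac hg hFm hF0 hintF
  have hintmap : Integrable (fun x => F ((P.map g).rnDeriv (Q.map g) (g x)).toReal) Q :=
    hmap.comp_measurable hg
  rw [fDiv, fDiv, if_pos ⟨hac.map hg, by simpa only [hFf] using hmap⟩, if_pos ⟨hac, hint⟩]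
  simp only [← hFf]
  refine EReal.coe_le_coe_iff.2 ?_
  rw [integral_map hg.aemeasurable hmap.aestronglyMeasurable]
  calc _ ≤ ∫ x, (Q[fun x => F (P.rnDeriv Q x).toReal |
          MeasurableSpace.comap g inferInstance]) x ∂Q :=
        integral_mono_ae hintmap integrable_condExp hle
    _ = _ := integral_condExp hg.comap_le

lemma ClassF.fDiv_self (h : ClassF f) (Q : Measure α) [IsFiniteMeasure Q] : fDiv f Q Q = 0 := by
  have := h.fDiv_withDensity Q (r := fun _ => 1) (u := 1) measurable_const
    fun _ => ⟨zero_le_one, le_rfl⟩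
  simpa [h.map_one] using this

/-- The choice `Q_B = P_B` in the infimum gives `I_f^MBGYA ≤ I_f^CKZ`. -/
lemma ClassF.mutualInfoMBGYA_le_CKZ (h : ClassF f) (P : Measure (α × β)) [IsProbabilityMeasure P] :
    mutualInfoMBGYA f P ≤ mutualInfoCKZ f P := by
  have h0 := h.fDiv_self P.snd
  refine (iInf_le _ ⟨P.snd, inferInstance, Measure.AbsolutelyContinuous.rfl, by simp [h0]⟩).trans ?_
  simp only [h0, sub_zero]
  exact le_rfl

end Divergence

section Uniform

variable {f : ℝ → ℝ}

instance uniformLaw_isProbabilityMeasure (m : ℕ) [NeZero m] :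
    IsProbabilityMeasure (uniformLaw m) :=
  inferInstanceAs (IsProbabilityMeasure (uniformOn Set.univ))

lemma uniformLaw_real_singleton (m : ℕ) (k : Fin m) : (uniformLaw m).real {k} = 1 / m := by
  rw [measureReal_def, uniformLaw, uniformOn_univ]
  simp

lemma uniformLaw_singleton_ne_zero (m : ℕ) (k : Fin m) : uniformLaw m {k} ≠ 0 := by
  rw [uniformLaw, uniformOn_univ]
  simp

/-- The law of `(A, A)` has density `1{k = l} / Q(l)` with respect to `P_A × Q`. -/
lemma map_diag_eq_withDensity {m : ℕ} (P Q : Measure (Fin m)) [IsFiniteMeasure P]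
    [IsFiniteMeasure Q] (hQ : ∀ l, Q {l} ≠ 0) :
    P.map (fun x => (x, x)) = (P.prod Q).withDensity fun p =>
      ENNReal.ofReal (if p.1 = p.2 then 1 / Q.real {p.2} else 0) := by
  refine Measure.ext_of_singleton fun ⟨k, l⟩ => ?_
  rw [Measure.map_apply .of_discrete (MeasurableSet.of_discrete),
    withDensity_apply _ (MeasurableSet.of_discrete), Measure.restrict_singleton,
    lintegral_smul_measure, lintegral_dirac, ← Set.singleton_prod_singleton, Measure.prod_prod]
  by_cases hkl : k = l
  · subst hkl
    have : (fun x : Fin m => (x, x)) ⁻¹' ({k} ×ˢ {k}) = {k} := by ext x; simp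
    have hpos : 0 < Q.real {k} := by
      rw [measureReal_def]
      exact ENNReal.toReal_pos (hQ k) (measure_ne_top _ _)
    rw [this, if_pos rfl, ENNReal.ofReal_div_of_pos hpos, ofReal_measureReal, ENNReal.ofReal_one,
      smul_eq_mul, mul_assoc, ENNReal.mul_div_cancel (hQ k) (measure_ne_top _ _), mul_one]
  · have : (fun x : Fin m => (x, x)) ⁻¹' ({k} ×ˢ {l}) = ∅ := by
      ext x
      simp only [Set.mem_preimage, Set.mem_prod, Set.mem_singleton_iff, Set.mem_empty_iff_false,
        iff_false]
      rintro ⟨rfl, rfl⟩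
      exact hkl rfl
    rw [this, measure_empty, if_neg hkl]
    simp

lemma eq_withDensity_singleton {m : ℕ} (P Q : Measure (Fin m)) [IsFiniteMeasure P]
    [IsFiniteMeasure Q] (hQ : ∀ l, Q {l} ≠ 0) :
    P = Q.withDensity fun l => ENNReal.ofReal (P.real {l} / Q.real {l}) := by
  refine Measure.ext_of_singleton fun l => ?_
  have hpos : 0 < Q.real {l} := by
    rw [measureReal_def]
    exact ENNReal.toReal_pos (hQ l) (measure_ne_top _ _)
  rw [withDensity_apply _ (MeasurableSet.of_discrete), Measure.restrict_singleton,
    lintegral_smul_measure, lintegral_dirac, ENNReal.ofReal_div_of_pos hpos, ofReal_measureReal,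
    ofReal_measureReal, smul_eq_mul, ENNReal.mul_div_cancel (hQ l) (measure_ne_top _ _)]

lemma exists_forall_mem_Icc {ι : Type*} [Finite ι] {r : ι → ℝ} (hr : ∀ i, 0 ≤ r i) :
    ∃ u, ∀ i, r i ∈ Set.Icc 0 u := by
  obtain ⟨u, hu⟩ := (Set.finite_range r).bddAbove
  exact ⟨u, fun i => ⟨hr i, hu ⟨i, rfl⟩⟩⟩

variable {m : ℕ} [NeZero m]

lemma ClassF.fDiv_uniformLaw_left (h : ClassF f) (Q : Measure (Fin m)) [IsProbabilityMeasure Q]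
    (hQ : ∀ l, Q {l} ≠ 0) :
    fDiv f (uniformLaw m) Q =
      ((∑ l, Q.real {l} * f (1 / (m * Q.real {l})) : ℝ) : EReal) := by
  obtain ⟨u, hu⟩ := exists_forall_mem_Icc
    (r := fun l => (uniformLaw m).real {l} / Q.real {l}) (fun l => by positivity)
  have := h.fDiv_withDensity Q (Measurable.of_discrete) hu
  rw [← eq_withDensity_singleton _ _ hQ] at this
  rw [this, integral_fintype Integrable.of_finite]
  simp only [uniformLaw_real_singleton, smul_eq_mul, div_div]

/-- The divergence of the diagonal law from `unif × Q`, with the off-diagonal contributions,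
where the density vanishes, collected in the term with `f 0`. -/
lemma ClassF.fDiv_diag_uniformLaw (h : ClassF f) (Q : Measure (Fin m)) [IsProbabilityMeasure Q]
    (hQ : ∀ l, Q {l} ≠ 0) :
    fDiv f ((uniformLaw m).map fun x => (x, x)) ((uniformLaw m).prod Q) =
      ((1 / m * ∑ l, Q.real {l} * f (1 / Q.real {l}) + (1 - 1 / m) * f 0 : ℝ) : EReal) := by
  have hm : (m : ℝ) ≠ 0 := Nat.cast_ne_zero.2 (NeZero.ne m)
  obtain ⟨u, hu⟩ := exists_forall_mem_Icc
    (r := fun p : Fin m × Fin m => if p.1 = p.2 then 1 / Q.real {p.2} else 0)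
    (fun p => by positivity)
  have := h.fDiv_withDensity ((uniformLaw m).prod Q) (Measurable.of_discrete) hu
  rw [← map_diag_eq_withDensity _ _ hQ] at this
  rw [this, integral_fintype Integrable.of_finite, Fintype.sum_prod_type_right]
  have hsum : ∑ l, Q.real {l} = 1 := by simp
  congr 1
  have hterm : ∀ l, ∑ k, ((uniformLaw m).prod Q).real {(k, l)} •
      f (if k = l then 1 / Q.real {l} else 0) =
      1 / m * (Q.real {l} * f (1 / Q.real {l})) + (1 - 1 / m) * f 0 * Q.real {l} := by
    intro l
    have e : ∀ k, ((uniformLaw m).prod Q).real {(k, l)} • f (if k = l then 1 / Q.real {l} else 0) =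
        1 / m * Q.real {l} * f 0 +
          if k = l then 1 / m * Q.real {l} * (f (1 / Q.real {l}) - f 0) else 0 := by
      intro k
      rw [← Set.singleton_prod_singleton, measureReal_prod_prod, uniformLaw_real_singleton]
      split_ifs
      · ring
      · rw [smul_eq_mul, add_zero]
    simp only [e, Finset.sum_add_distrib, Finset.sum_const, Finset.sum_ite_eq', Finset.mem_univ,
      if_true, Finset.card_univ, Fintype.card_fin, nsmul_eq_mul]
    field_simp
    ring
  simp only [hterm, Finset.sum_add_distrib, ← Finset.mul_sum, hsum, mul_one]

lemma ClassF.entropyCKZ_uniformLaw (h : ClassF f) :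
    entropyCKZ f (uniformLaw m) = ((f 0 * (1 - 1 / m) + 1 / m * f m : ℝ) : EReal) := by
  have hm : (m : ℝ) ≠ 0 := Nat.cast_ne_zero.2 (NeZero.ne m)
  have e1 : ((uniformLaw m).map fun x => (x, x)).fst = uniformLaw m := by
    rw [Measure.fst_map_prodMk measurable_id']; exact Measure.map_id
  have e2 : ((uniformLaw m).map fun x => (x, x)).snd = uniformLaw m := by
    rw [Measure.snd_map_prodMk measurable_id']; exact Measure.map_id
  rw [entropyCKZ, mutualInfoCKZ, e1, e2,
    h.fDiv_diag_uniformLaw _ (uniformLaw_singleton_ne_zero m)]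
  congr 1
  simp only [uniformLaw_real_singleton, one_div_one_div, Finset.sum_const, Finset.card_univ,
    Fintype.card_fin, nsmul_eq_mul]
  field_simp
  ring

/-- For a uniform variable the two `f`-entropies agree: the functional minimized in the definition
of `H_f^MBGYA` is convex and symmetric in `Q`, hence smallest at the uniform law. -/
lemma ClassF.le_entropyMBGYA_uniformLaw (h : ClassF f) :
    ((f 0 * (1 - 1 / m) + 1 / m * f m : ℝ) : EReal) ≤ entropyMBGYA f (uniformLaw m) := by
  have hm : (m : ℝ) ≠ 0 := Nat.cast_ne_zero.2 (NeZero.ne m)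
  have hm1 : (1 : ℝ) ≤ m := by exact_mod_cast NeZero.one_le
  have e1 : ((uniformLaw m).map fun x => (x, x)).fst = uniformLaw m := by
    rw [Measure.fst_map_prodMk measurable_id']; exact Measure.map_id
  have e2 : ((uniformLaw m).map fun x => (x, x)).snd = uniformLaw m := by
    rw [Measure.snd_map_prodMk measurable_id']; exact Measure.map_id
  rw [entropyMBGYA, mutualInfoMBGYA, e1, e2]
  refine le_iInf ?_
  rintro ⟨Q, hprob, hac, -⟩
  have hQ : ∀ l, Q {l} ≠ 0 := fun l hl => uniformLaw_singleton_ne_zero m l (hac hl)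
  simp only
  rw [h.fDiv_diag_uniformLaw Q hQ, h.fDiv_uniformLaw_left Q hQ, ← EReal.coe_sub]
  refine EReal.coe_le_coe_iff.2 ?_
  have hsum : ∑ l, Q.real {l} = 1 := by simp
  have hJ := (h.convexOn_perspective_sub hm1).map_sum_le (t := Finset.univ)
    (w := fun _ : Fin m => 1 / (m : ℝ)) (p := fun l => Q.real {l}) (fun _ _ => by positivity)
    (by simp [hm]) (fun l _ => ENNReal.toReal_pos (hQ l) (measure_ne_top _ _))
  simp only [smul_eq_mul, ← Finset.mul_sum, hsum, mul_one, one_div_one_div, mul_one_div_cancel hm,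
    div_one, h.map_one, mul_zero, sub_zero, Finset.sum_sub_distrib] at hJ
  have e : 1 / (m : ℝ) * (∑ l, Q.real {l} * f (1 / Q.real {l}) -
      m * ∑ l, Q.real {l} * f (1 / (m * Q.real {l}))) =
      1 / m * ∑ l, Q.real {l} * f (1 / Q.real {l}) -
        ∑ l, Q.real {l} * f (1 / (m * Q.real {l})) := by
    field_simp
  rw [e] at hJ
  linarith

end Uniform

/-! ### Time sharing over the coordinates of a code -/

section Resampling

variable {X : Type*} [MeasurableSpace X]

/-- Replacing one coordinate of an i.i.d. vector by an independent copy does not change its law. -/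
lemma measurePreserving_update (μ : Measure X) [IsProbabilityMeasure μ] {n : ℕ} (i : Fin n) :
    MeasurePreserving (fun p : X × (Fin n → X) => Function.update p.2 i p.1)
      (μ.prod (Measure.pi fun _ => μ)) (Measure.pi fun _ => μ) := by
  refine ⟨measurable_update_prod i, (Measure.pi_eq fun s hs => ?_).symm⟩
  rw [Measure.map_apply (measurable_update_prod i) (MeasurableSet.univ_pi hs)]
  have e : (fun p : X × (Fin n → X) => Function.update p.2 i p.1) ⁻¹' Set.univ.pi s =
      s i ×ˢ Set.univ.pi (Function.update s i Set.univ) := by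
    ext p
    simp only [Set.mem_preimage, Set.mem_univ_pi, Set.mem_prod]
    constructor
    · intro hp
      refine ⟨by simpa using hp i, fun j => ?_⟩
      by_cases hj : j = i
      · subst hj; simp
      · simpa [hj] using hp j
    · rintro ⟨h1, h2⟩ j
      by_cases hj : j = i
      · subst hj; simpa using h1
      · simpa [hj] using h2 j
  rw [e, Measure.prod_prod, Measure.pi_pi,
    ← Finset.mul_prod_erase Finset.univ _ (Finset.mem_univ i),
    ← Finset.mul_prod_erase Finset.univ (fun j => μ (s j)) (Finset.mem_univ i)]
  simp only [Function.update_self, measure_univ, one_mul]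
  congr 1
  refine Finset.prod_congr rfl fun j hj => ?_
  rw [Function.update_of_ne (Finset.ne_of_mem_erase hj)]

/-- Conditioning on the `i`-th coordinate of an i.i.d. vector: the conditional law of the vector
given that its `i`-th coordinate is `x` is that of `Function.update z i x`. -/
lemma pi_inter_eq_lintegral (μ : Measure X) [IsProbabilityMeasure μ] {n : ℕ} (i : Fin n)
    {s : Set X} (hs : MeasurableSet s) {B : Set (Fin n → X)} (hB : MeasurableSet B) :
    Measure.pi (fun _ => μ) ({z | z i ∈ s} ∩ B) =
      ∫⁻ x in s, Measure.pi (fun _ => μ) {z | Function.update z i x ∈ B} ∂μ := by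
  have hs' : MeasurableSet {z : Fin n → X | z i ∈ s} := measurable_pi_apply i hs
  have hm := (measurePreserving_update μ i).measurable
  rw [← (measurePreserving_update μ i).measure_preimage (hs'.inter hB).nullMeasurableSet,
    Measure.prod_apply (hm (hs'.inter hB)), ← lintegral_indicator hs]
  refine lintegral_congr fun x => ?_
  by_cases hx : x ∈ s
  · rw [Set.indicator_of_mem hx]
    congr 1
    ext z
    simp [hx]
  · rw [Set.indicator_of_notMem hx]
    have e : Prod.mk x ⁻¹' ((fun p : X × (Fin n → X) => Function.update p.2 i p.1) ⁻¹'
        ({z | z i ∈ s} ∩ B)) = ∅ := by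
      ext z
      simp [hx]
    rw [e, measure_empty]

end Resampling

section Code

variable {X Y : Type*} [MeasurableSpace X] [MeasurableSpace Y]

/-- The law of `(X_T, (T, K))`, where `K` is the encoded message of an i.i.d. vector `X₁, …, X_n`
and the time index `T` is uniform and independent of the vector. -/
def timeSharedLaw (μ : Measure X) {n m : ℕ} (enc : (Fin n → X) → Fin m) :
    Measure (X × (Fin n × Fin m)) :=
  ((uniformLaw n).prod (Measure.pi fun _ => μ)).map fun p => (p.2 p.1, (p.1, enc p.2))

/-- The channel from `X` to the time-shared reproduction `dec K T`: given the input `x`, all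
coordinates but the `T`-th are drawn afresh and the `T`-th is set to `x`. -/
def timeSharedKernel (μ : Measure X) {n m : ℕ} (enc : (Fin n → X) → Fin m)
    (dec : Fin n × Fin m → Y) : Kernel X Y :=
  (Kernel.id ×ₖ Kernel.const X ((uniformLaw n).prod (Measure.pi fun _ => μ))).map
    fun p => dec (p.2.1, enc (Function.update p.2.2 p.2.1 p.1))

variable {n m : ℕ} {enc : (Fin n → X) → Fin m}

lemma measurable_timeShare (henc : Measurable enc) :
    Measurable fun p : Fin n × (Fin n → X) => (p.2 p.1, (p.1, enc p.2)) :=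
  measurable_from_prod_countable_right fun i => (measurable_pi_apply i).prodMk
    (measurable_const.prodMk henc)

lemma measurable_timeShare_update (henc : Measurable enc) (dec : Fin n × Fin m → Y) :
    Measurable fun p : X × (Fin n × (Fin n → X)) =>
      dec (p.2.1, enc (Function.update p.2.2 p.2.1 p.1)) := by
  have h1 : Measurable fun p : Fin n × (X × (Fin n → X)) =>
      dec (p.1, enc (Function.update p.2.2 p.1 p.2.1)) :=
    measurable_from_prod_countable_right fun i => (Measurable.of_discrete (f := dec)).comp
      (measurable_const.prodMk (henc.comp (measurable_update_prod i)))
  exact h1.comp ((measurable_fst.comp measurable_snd).prodMk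
    (measurable_fst.prodMk (measurable_snd.comp measurable_snd)))

variable (μ : Measure X) [IsProbabilityMeasure μ]

/-- The conditional probability that the message is `k` given that the `i`-th source symbol
is `x`, as a function of `(x, (i, k))`. -/
def messageProb (enc : (Fin n → X) → Fin m) (p : X × (Fin n × Fin m)) : ℝ :=
  (Measure.pi fun _ : Fin n => μ).real {z | Function.update z p.2.1 p.1 ∈ enc ⁻¹' {p.2.2}}

lemma measurable_messageProb (henc : Measurable enc) : Measurable (messageProb μ enc) := by
  refine measurable_from_prod_countable_left fun w => Measurable.ennreal_toReal ?_
  exact measurable_measure_prodMk_left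
    ((measurable_update_prod w.1) (henc (MeasurableSet.singleton w.2)))

/-- The density `P(K = k | X_i = x) / P(K = k)` of the law of `(X_T, (T, K))` with respect to the
product of its marginals. It is `0` where `P(K = k) = 0`. -/
def messageDensity (enc : (Fin n → X) → Fin m) (p : X × (Fin n × Fin m)) : ℝ :=
  messageProb μ enc p / ((Measure.pi fun _ : Fin n => μ).map enc).real {p.2.2}

lemma measurable_messageDensity (henc : Measurable enc) : Measurable (messageDensity μ enc) :=
  (measurable_messageProb μ henc).div ((Measurable.of_discrete (f := fun k : Fin m =>
    ((Measure.pi fun _ : Fin n => μ).map enc).real {k})).comp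
      (measurable_snd.comp measurable_snd))

lemma snd_timeSharedLaw (henc : Measurable enc) :
    (timeSharedLaw μ enc).map Prod.snd =
      (uniformLaw n).prod ((Measure.pi fun _ => μ).map enc) := by
  have : IsZeroOrProbabilityMeasure (uniformLaw n) :=
    inferInstanceAs (IsZeroOrProbabilityMeasure (uniformOn Set.univ))
  have e := Measure.map_prod_map (uniformLaw n) (Measure.pi fun _ : Fin n => μ) measurable_id henc
  rw [Measure.map_id] at e
  rw [timeSharedLaw, Measure.map_map measurable_snd (measurable_timeShare henc), e]
  rfl

variable [NeZero n]

lemma timeSharedLaw_eq_withDensity (henc : Measurable enc) :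
    timeSharedLaw μ enc =
      (μ.prod ((uniformLaw n).prod ((Measure.pi fun _ => μ).map enc))).withDensity fun p =>
        ENNReal.ofReal (messageDensity μ enc p) := by
  have hJ : IsProbabilityMeasure (timeSharedLaw μ enc) :=
    Measure.isProbabilityMeasure_map (measurable_timeShare henc).aemeasurable
  have hπ : IsProbabilityMeasure ((Measure.pi fun _ : Fin n => μ).map enc) :=
    Measure.isProbabilityMeasure_map henc.aemeasurable
  -- As `Fin n × Fin m` is finite, it suffices to compare the measures on the sets `s ×ˢ {w}`.
  have hsing : ∀ {s : Set X}, MeasurableSet s → ∀ w : Fin n × Fin m,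
      timeSharedLaw μ enc (s ×ˢ {w}) =
      (μ.prod ((uniformLaw n).prod ((Measure.pi fun _ => μ).map enc))).withDensity (fun p =>
        ENNReal.ofReal (messageDensity μ enc p))
        (s ×ˢ {w}) := by
    rintro s hs ⟨i, k⟩
    have hsw : MeasurableSet (s ×ˢ {((i, k) : Fin n × Fin m)}) := hs.prod (.singleton _)
    have hpre : (fun p : Fin n × (Fin n → X) => (p.2 p.1, (p.1, enc p.2))) ⁻¹' (s ×ˢ {(i, k)}) =
        {i} ×ˢ ({z | z i ∈ s} ∩ enc ⁻¹' {k}) := by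
      ext ⟨j, z⟩
      simp only [Set.mem_preimage, Set.mem_prod, Set.mem_singleton_iff, Prod.mk.injEq,
        Set.mem_inter_iff, Set.mem_ofPred_eq]
      constructor
      · rintro ⟨h1, rfl, h2⟩; exact ⟨rfl, h1, h2⟩
      · rintro ⟨rfl, h1, h2⟩; exact ⟨h1, rfl, h2⟩
    rw [timeSharedLaw, Measure.map_apply (measurable_timeShare henc) hsw, hpre, Measure.prod_prod,
      withDensity_apply _ hsw, ← Measure.prod_restrict, Measure.restrict_singleton,
      lintegral_prod _ (measurable_messageDensity μ henc).ennreal_ofReal.aemeasurable]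
    simp only [lintegral_smul_measure, lintegral_dirac, smul_eq_mul]
    rw [← Set.singleton_prod_singleton, Measure.prod_prod,
      lintegral_const_mul' _ _ (ENNReal.mul_ne_top (measure_ne_top _ _) (measure_ne_top _ _)),
      mul_assoc, ← lintegral_const_mul' _ _ (measure_ne_top _ _)]
    congr 1
    by_cases hk : ((Measure.pi fun _ : Fin n => μ).map enc) {k} = 0
    · have h0 : Measure.pi (fun _ => μ) ({z | z i ∈ s} ∩ enc ⁻¹' {k}) = 0 :=
        measure_mono_null Set.inter_subset_right (by
          rwa [Measure.map_apply henc (.singleton k)] at hk)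
      simp [h0, hk]
    · rw [pi_inter_eq_lintegral μ i hs (henc (.singleton k))]
      refine lintegral_congr fun x => ?_
      have hpos : 0 < ((Measure.pi fun _ : Fin n => μ).map enc).real {k} :=
        ENNReal.toReal_pos hk (measure_ne_top _ _)
      rw [messageDensity, ENNReal.ofReal_div_of_pos hpos, ofReal_measureReal,
        ENNReal.mul_div_cancel hk (measure_ne_top _ _), messageProb, ofReal_measureReal]
  refine Measure.ext_prod fun {s t} hs _ => ?_
  have hU : s ×ˢ t = ⋃ w ∈ t, s ×ˢ {w} := by
    ext ⟨x, w⟩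
    simp
  have hd : t.PairwiseDisjoint fun w => s ×ˢ ({w} : Set (Fin n × Fin m)) := by
    intro w _ w' _ hww
    exact Set.disjoint_left.2 fun p hp hp' => hww (hp.2.symm.trans hp'.2)
  rw [hU, measure_biUnion t.to_countable hd fun w _ => hs.prod (.singleton w),
    measure_biUnion t.to_countable hd fun w _ => hs.prod (.singleton w)]
  exact tsum_congr fun w => hsing hs w

/-- The joint law of the input and output of the time-shared channel is that of
`(X_T, dec (T, K))`. -/
lemma compProd_timeSharedKernel (henc : Measurable enc) (dec : Fin n × Fin m → Y) :
    μ ⊗ₘ timeSharedKernel μ enc dec = (timeSharedLaw μ enc).map (Prod.map id dec) := by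
  have hdec : Measurable (Prod.map id dec : X × (Fin n × Fin m) → X × Y) :=
    measurable_id.prodMap .of_discrete
  have hκm := measurable_timeShare_update henc dec
  have hκ : IsMarkovKernel (timeSharedKernel μ enc dec) := Kernel.IsMarkovKernel.map _ hκm
  refine Measure.ext_prod fun {s t} hs ht => ?_
  rw [Measure.compProd_apply_prod hs ht, timeSharedLaw,
    Measure.map_map hdec (measurable_timeShare henc),
    Measure.map_apply (hdec.comp (measurable_timeShare henc)) (hs.prod ht)]
  have hB : ∀ i, MeasurableSet {z : Fin n → X | dec (i, enc z) ∈ t} := fun i =>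
    ((Measurable.of_discrete (f := dec)).comp (measurable_const.prodMk henc)) ht
  have e1 : ∀ x, timeSharedKernel μ enc dec x t = ∑ i, uniformLaw n {i} *
      Measure.pi (fun _ => μ) {z | Function.update z i x ∈ {z | dec (i, enc z) ∈ t}} := fun x => by
    rw [timeSharedKernel, Kernel.map_apply' _ hκm _ ht, Kernel.prod_apply, Kernel.id_apply,
      Kernel.const_apply, Measure.prod_apply (hκm ht), lintegral_dirac' _
        (measurable_measure_prodMk_left (hκm ht)), Measure.prod_apply
        (measurable_prodMk_left (hκm ht)), lintegral_fintype]
    exact Finset.sum_congr rfl fun i _ => mul_comm _ _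
  have hpre := measurable_timeShare henc
  rw [Measure.prod_apply ((hdec.comp hpre) (hs.prod ht)), lintegral_fintype (μ := uniformLaw n)]
  simp only [e1]
  rw [lintegral_finsetSum' _ fun i _ => ?_]
  · refine Finset.sum_congr rfl fun i _ => ?_
    rw [lintegral_const_mul' _ _ (measure_ne_top _ _), ← pi_inter_eq_lintegral μ i hs (hB i),
      mul_comm]
    rfl
  · exact ((measurable_measure_prodMk_left ((measurable_update_prod i) (hB i))).const_mul
      _).aemeasurable

end Code

/-! ### The single-letter converse -/

section Converse

variable {X Y : Type*} [MeasurableSpace X] [MeasurableSpace Y] {f : ℝ → ℝ} {n m : ℕ}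
  {enc : (Fin n → X) → Fin m}

/-- Among laws on `m` points the uniform law maximizes `H_f^CKZ`: with `φ t = (f t - f 0) / t`,
which is concave and nondecreasing, the entropy is `f 0 + ∑ p φ(1/p)`. -/
lemma ClassF.sum_le_entropy_uniform (h : ClassF f) [NeZero m] {p : Fin m → ℝ} (hp : ∀ k, 0 ≤ p k)
    (hsum : ∑ k, p k = 1) :
    ∑ k, p k * (p k * f (1 / p k) + (1 - p k) * f 0) ≤ f 0 * (1 - 1 / m) + 1 / m * f m := by
  have hm : 0 < (m : ℝ) := Nat.cast_pos.2 (NeZero.pos m)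
  set S : Finset (Fin m) := Finset.univ.filter fun k => 0 < p k with hS
  have hpS : ∀ k ∈ S, 0 < p k := fun k hk => (Finset.mem_filter.1 hk).2
  have hnS : ∀ k, k ∉ S → p k = 0 := fun k hk => by
    by_contra hne
    exact hk (Finset.mem_filter.2 ⟨Finset.mem_univ _, (hp k).lt_of_ne' hne⟩)
  have hsumS : ∑ k ∈ S, p k = 1 := by
    rw [← hsum]
    exact Finset.sum_subset (Finset.subset_univ S) fun k _ hk => hnS k hk
  have hcard : (S.card : ℝ) ≤ m := by
    have := Finset.card_le_univ S
    rw [Fintype.card_fin] at this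
    exact_mod_cast this
  have hcard0 : 0 < (S.card : ℝ) := by
    rw [Nat.cast_pos, Finset.card_pos]
    by_contra hne
    rw [Finset.not_nonempty_iff_eq_empty.1 hne] at hsumS
    simp at hsumS
  have hJ := h.concaveOn_slope_zero.le_map_sum (t := S) (w := p) (p := fun k => 1 / p k)
    (fun k _ => hp k) hsumS fun k hk => one_div_pos.2 (hpS k hk)
  have hone : ∑ k ∈ S, p k • (1 / p k) = S.card := by
    rw [Finset.sum_congr rfl fun k hk => (by
      rw [smul_eq_mul, mul_one_div_cancel (hpS k hk).ne'] : p k • (1 / p k) = 1)]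
    simp
  simp only [hone] at hJ
  have hmono := h.monotoneOn_slope_zero hcard0 hm hcard
  have hterm : ∑ k, p k * (p k * f (1 / p k) + (1 - p k) * f 0) =
      f 0 + ∑ k ∈ S, p k • ((f (1 / p k) - f 0) / (1 / p k)) := by
    have e : ∀ k ∈ S, p k • ((f (1 / p k) - f 0) / (1 / p k)) =
        p k * (p k * (f (1 / p k) - f 0)) := fun k hk => by
      rw [smul_eq_mul, div_div_eq_mul_div, div_one, mul_comm (f _ - f 0)]
    rw [Finset.sum_congr rfl e, Finset.sum_subset (Finset.subset_univ S) fun k _ hk => by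
      rw [hnS k hk, zero_mul]]
    have : f 0 = ∑ k, p k * f 0 := by rw [← Finset.sum_mul, hsum, one_mul]
    nth_rewrite 2 [this]
    rw [← Finset.sum_add_distrib]
    exact Finset.sum_congr rfl fun k _ => by ring
  rw [hterm]
  have hlast : f 0 * (1 - 1 / m) + 1 / m * f m = f 0 + (f m - f 0) / m := by field_simp; ring
  rw [hlast]
  exact add_le_add le_rfl (hJ.trans hmono)

variable (μ : Measure X) [IsProbabilityMeasure μ]

/-- Superadditivity for a single message of positive probability. -/
lemma ClassF.sum_integral_messageProb_le (h : ClassF f) (henc : Measurable enc) (k : Fin m)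
    (hk : 0 < ((Measure.pi fun _ : Fin n => μ).map enc).real {k}) :
    ∑ i, ∫ x, f (messageDensity μ enc (x, (i, k))) ∂μ ≤
      ((Measure.pi fun _ : Fin n => μ).map enc).real {k} *
        f (1 / ((Measure.pi fun _ : Fin n => μ).map enc).real {k}) +
      (1 - ((Measure.pi fun _ : Fin n => μ).map enc).real {k}) * f 0 := by
  set P : Measure (Fin n → X) := Measure.pi fun _ => μ with hP
  set c : ℝ := (P.map enc).real {k} with hc
  set A : Set (Fin n → X) := enc ⁻¹' {k} with hA
  have hAm : MeasurableSet A := henc (.singleton k)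
  have hcA : c = P.real A := by
    rw [hc, measureReal_def, measureReal_def, Measure.map_apply henc (.singleton k)]
  -- The density of the conditional law of the source vector given the message `k`.
  set g : (Fin n → X) → ℝ := fun z => A.indicator (fun _ => 1 / c) z with hg
  have hgm : Measurable g := measurable_const.indicator hAm
  have hmem : ∀ z, g z ∈ Set.Icc 0 (1 / c) := fun z => by
    by_cases hz : z ∈ A
    · simp [hg, hz, hk.le]
    · simp [hg, hz, hk.le]
  have hmain := h.sum_integral_marginals_le μ hgm hmem
  have e1 : ∀ i x, ∫ z, g (Function.update z i x) ∂P = messageDensity μ enc (x, (i, k)) := by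
    intro i x
    have hB : MeasurableSet {z : Fin n → X | Function.update z i x ∈ A} :=
      ((measurable_update_prod i).comp measurable_prodMk_left) hAm
    have : (fun z => g (Function.update z i x)) =
        {z : Fin n → X | Function.update z i x ∈ A}.indicator fun _ => 1 / c := by
      funext z
      simp [hg, Set.indicator]
    rw [this, integral_indicator_const _ hB, smul_eq_mul, mul_one_div]
    rfl
  have e2 : ∫ z, g z ∂P = 1 := by
    rw [hg, integral_indicator_const _ hAm, smul_eq_mul, ← hcA, mul_one_div_cancel hk.ne']
  have e3 : ∫ z, f (g z) ∂P = c * f (1 / c) + (1 - c) * f 0 := by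
    have : (fun z => f (g z)) = fun z => A.indicator (fun _ => f (1 / c) - f 0) z + f 0 := by
      funext z
      by_cases hz : z ∈ A
      · simp [hg, hz]
      · simp [hg, hz]
    rw [this, integral_add ((integrable_const _).indicator hAm) (integrable_const _),
      integral_indicator_const _ hAm, smul_eq_mul, ← hcA]
    simp
    ring
  simp only [← hP, e1, e2, e3, h.map_one, mul_zero, add_zero] at hmain
  exact hmain

lemma messageDensity_mem_Icc :
    ∃ u, ∀ p, messageDensity μ enc p ∈ Set.Icc 0 u := by
  obtain ⟨u, hu⟩ := exists_forall_mem_Icc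
    (r := fun k => 1 / ((Measure.pi fun _ : Fin n => μ).map enc).real {k}) fun k => by positivity
  refine ⟨u, fun p => ⟨div_nonneg measureReal_nonneg measureReal_nonneg, le_trans ?_ (hu p.2.2).2⟩⟩
  exact div_le_div_of_nonneg_right measureReal_le_one measureReal_nonneg

variable [NeZero n]

/-- The `f`-information between `X_T` and `(T, K)` is at most `1/n` times the largest `f`-entropy
of a law on `m` points. -/
lemma ClassF.integral_messageDensity_le (h : ClassF f) [NeZero m] (henc : Measurable enc) :
    ∫ p, f (messageDensity μ enc p)
        ∂(μ.prod ((uniformLaw n).prod ((Measure.pi fun _ => μ).map enc))) ≤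
      1 / n * (f 0 * (1 - 1 / m) + 1 / m * f m) := by
  set π : Measure (Fin m) := (Measure.pi fun _ : Fin n => μ).map enc with hπ
  have hπp : IsProbabilityMeasure π := Measure.isProbabilityMeasure_map henc.aemeasurable
  obtain ⟨u, hu⟩ := messageDensity_mem_Icc (enc := enc) μ
  have hb : BddMeas fun p => f (messageDensity μ enc p) :=
    BddMeas.of_continuousOn (h.continuousOn.mono Set.Icc_subset_Ici_self)
      (measurable_messageDensity μ henc) hu
  rw [integral_prod_symm _ (hb.integrable _), integral_fintype Integrable.of_finite,
    Fintype.sum_prod_type_right]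
  have hk : ∀ k, ∑ i, ((uniformLaw n).prod π).real {(i, k)} •
      ∫ x, f (messageDensity μ enc (x, (i, k))) ∂μ ≤
      1 / n * (π.real {k} * (π.real {k} * f (1 / π.real {k}) + (1 - π.real {k}) * f 0)) := by
    intro k
    have e : ∑ i, ((uniformLaw n).prod π).real {(i, k)} •
        ∫ x, f (messageDensity μ enc (x, (i, k))) ∂μ =
        1 / n * (π.real {k} * ∑ i, ∫ x, f (messageDensity μ enc (x, (i, k))) ∂μ) := by
      rw [Finset.mul_sum, Finset.mul_sum]
      refine Finset.sum_congr rfl fun i _ => ?_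
      rw [← Set.singleton_prod_singleton, measureReal_prod_prod, uniformLaw_real_singleton,
        smul_eq_mul, mul_assoc]
    rw [e]
    refine mul_le_mul_of_nonneg_left ?_ (by positivity)
    rcases (measureReal_nonneg (μ := π) (s := {k})).eq_or_lt with h0 | hpos
    · rw [← h0]; simp
    · exact mul_le_mul_of_nonneg_left (h.sum_integral_messageProb_le μ henc k hpos) hpos.le
  refine (Finset.sum_le_sum fun k _ => hk k).trans ?_
  rw [← Finset.mul_sum]
  exact mul_le_mul_of_nonneg_left
    (h.sum_le_entropy_uniform (fun k => measureReal_nonneg) (by simp)) (by positivity)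

/-- The single-letter bound on the `f`-information of the time-shared channel. -/
lemma ClassF.mutualInfoCKZ_timeShared_le (h : ClassF f) [NeZero m] (henc : Measurable enc)
    (dec : Fin n × Fin m → Y) :
    mutualInfoCKZ f (μ ⊗ₘ timeSharedKernel μ enc dec) ≤
      ((1 / n * (f 0 * (1 - 1 / m) + 1 / m * f m) : ℝ) : EReal) := by
  have hκ : IsMarkovKernel (timeSharedKernel μ enc dec) :=
    Kernel.IsMarkovKernel.map _ (measurable_timeShare_update henc dec)
  have hJ : IsProbabilityMeasure (timeSharedLaw μ enc) :=
    Measure.isProbabilityMeasure_map (measurable_timeShare henc).aemeasurable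
  have hπ : IsProbabilityMeasure ((Measure.pi fun _ : Fin n => μ).map enc) :=
    Measure.isProbabilityMeasure_map henc.aemeasurable
  set ν := (uniformLaw n).prod ((Measure.pi fun _ : Fin n => μ).map enc) with hν
  have hdec : Measurable (Prod.map id dec : X × (Fin n × Fin m) → X × Y) :=
    measurable_id.prodMap .of_discrete
  have hsnd : (μ ⊗ₘ timeSharedKernel μ enc dec).snd = ν.map dec := by
    rw [compProd_timeSharedKernel μ henc dec, Measure.snd, Measure.map_map measurable_snd hdec,
      hν, ← snd_timeSharedLaw μ henc, Measure.map_map .of_discrete measurable_snd]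
    rfl
  have hprod : μ.prod (ν.map dec) = (μ.prod ν).map (Prod.map id dec) := by
    have := Measure.map_prod_map μ ν measurable_id (Measurable.of_discrete (f := dec))
    rwa [Measure.map_id] at this
  rw [mutualInfoCKZ, Measure.fst_compProd, hsnd, hprod, compProd_timeSharedKernel μ henc dec]
  refine (h.fDiv_map_le _ _ hdec).trans ?_
  obtain ⟨u, hu⟩ := messageDensity_mem_Icc (enc := enc) μ
  rw [timeSharedLaw_eq_withDensity μ henc,
    h.fDiv_withDensity _ (measurable_messageDensity μ henc) hu]
  exact EReal.coe_le_coe_iff.2 (h.integral_messageDensity_le μ henc)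

lemma integral_timeShared (henc : Measurable enc) (dec : Fin n × Fin m → Y) {d : X → Y → ℝ}
    (hd : Measurable (Function.uncurry d))
    (hint : ∀ i, Integrable (fun z : Fin n → X => d (z i) (dec (i, enc z)))
      (Measure.pi fun _ => μ)) :
    Integrable (fun p : X × Y => d p.1 p.2) (μ ⊗ₘ timeSharedKernel μ enc dec) ∧
      ∫ p : X × Y, d p.1 p.2 ∂(μ ⊗ₘ timeSharedKernel μ enc dec) =
        1 / n * ∑ i, ∫ z : Fin n → X, d (z i) (dec (i, enc z)) ∂(Measure.pi fun _ => μ) := by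
  have hdec : Measurable (Prod.map id dec : X × (Fin n × Fin m) → X × Y) :=
    measurable_id.prodMap .of_discrete
  have hts := measurable_timeShare henc
  have hd' : Measurable fun p : X × Y => d p.1 p.2 := hd
  have hmeas : Measurable fun p : Fin n × (Fin n → X) => d (p.2 p.1) (dec (p.1, enc p.2)) :=
    hd'.comp (hdec.comp hts)
  have hi : Integrable (fun p : Fin n × (Fin n → X) => d (p.2 p.1) (dec (p.1, enc p.2)))
      ((uniformLaw n).prod (Measure.pi fun _ => μ)) :=
    (integrable_prod_iff hmeas.aestronglyMeasurable).2
      ⟨ae_of_all _ fun i => hint i, Integrable.of_finite⟩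
  rw [compProd_timeSharedKernel μ henc dec, timeSharedLaw, Measure.map_map hdec hts]
  refine ⟨(integrable_map_measure hd'.aestronglyMeasurable (hdec.comp hts).aemeasurable).2 hi, ?_⟩
  rw [integral_map (hdec.comp hts).aemeasurable hd'.aestronglyMeasurable]
  refine (integral_prod _ hi).trans ?_
  rw [integral_fintype Integrable.of_finite, Finset.mul_sum]
  exact Finset.sum_congr rfl fun i _ => by
    rw [uniformLaw_real_singleton, smul_eq_mul]

end Converse

end FInfo

end

theorem mainTheorem2 {X Y : Type*} [MeasurableSpace X] [MeasurableSpace Y]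
    (μ : Measure X) [IsProbabilityMeasure μ]
    (d : X → Y → ℝ) (hd : Measurable (Function.uncurry d))
    (n : ℕ) (hn : 1 ≤ n) (R D : ℝ)
    (code : FInfo.LossySourceCode μ d n R D) :
    ∃ (κ : Kernel X Y) (_ : IsMarkovKernel κ),
      (Integrable (fun p : X × Y => d p.1 p.2) (μ ⊗ₘ κ) ∧
        ∫ p : X × Y, d p.1 p.2 ∂(μ ⊗ₘ κ) ≤ D) ∧
      ∀ f : ℝ → ℝ, FInfo.ClassF f →
        FInfo.mutualInfoCKZ f (μ ⊗ₘ κ) ≤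
          ((1 / (n : ℝ) : ℝ) : EReal) *
            FInfo.entropyCKZ f (FInfo.uniformLaw (FInfo.numMessages n R)) ∧
        FInfo.mutualInfoMBGYA f (μ ⊗ₘ κ) ≤
          ((1 / (n : ℝ) : ℝ) : EReal) *
            FInfo.entropyMBGYA f (FInfo.uniformLaw (FInfo.numMessages n R)) ∧
        FInfo.mutualInfoCKZ f (μ ⊗ₘ κ) ≤
          ((1 / (n : ℝ) * (f 0 * (1 - (2 : ℝ) ^ (-((n : ℝ) * R))) +
            (2 : ℝ) ^ (-((n : ℝ) * R)) * f ((2 : ℝ) ^ ((n : ℝ) * R))) : ℝ) : EReal) ∧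
        ((FInfo.numMessages n R : ℝ) = (2 : ℝ) ^ ((n : ℝ) * R) →
          FInfo.entropyCKZ f (FInfo.uniformLaw (FInfo.numMessages n R)) =
            ((f 0 * (1 - (2 : ℝ) ^ (-((n : ℝ) * R))) +
              (2 : ℝ) ^ (-((n : ℝ) * R)) * f ((2 : ℝ) ^ ((n : ℝ) * R)) : ℝ) : EReal)) := by
  have hn0 : NeZero n := ⟨by omega⟩
  -- A code has at least one message, since the source alphabet is nonempty.
  obtain ⟨x₀⟩ : Nonempty X := Measure.nonempty_of_neZero μ
  have hm0 : NeZero (FInfo.numMessages n R) := ⟨fun h => by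
    have k := code.enc fun _ => x₀
    rw [h] at k
    exact k.elim0⟩
  set m := FInfo.numMessages n R with hm
  have henc := code.measurable_enc
  set dec : Fin n × Fin m → Y := fun w => code.dec w.2 w.1 with hdec
  have hκ : IsMarkovKernel (FInfo.timeSharedKernel μ code.enc dec) :=
    Kernel.IsMarkovKernel.map _ (FInfo.measurable_timeShare_update henc dec)
  obtain ⟨hi, he⟩ := FInfo.integral_timeShared μ henc dec hd code.integrable_distortion
  refine ⟨FInfo.timeSharedKernel μ code.enc dec, hκ, ⟨hi, he.trans_le code.distortion_le⟩, ?_⟩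
  intro f hf
  have hbound := hf.mutualInfoCKZ_timeShared_le μ henc dec
  have hn' : (0 : EReal) ≤ ((1 / (n : ℝ) : ℝ) : EReal) := EReal.coe_nonneg.2 (by positivity)
  set T : ℝ := (2 : ℝ) ^ ((n : ℝ) * R) with hT
  have hT0 : 0 < T := by positivity
  have hinv : (2 : ℝ) ^ (-((n : ℝ) * R)) = 1 / T := by
    rw [Real.rpow_neg zero_le_two, one_div]
  rw [hinv]
  have hmpos : (0 : ℝ) < m := Nat.cast_pos.2 (NeZero.pos m)
  have hmT : (m : ℝ) ≤ T := Nat.floor_le hT0.le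
  refine ⟨?_, ?_, ?_, ?_⟩
  · rw [hf.entropyCKZ_uniformLaw, ← EReal.coe_mul]
    exact hbound
  · refine (hf.mutualInfoMBGYA_le_CKZ _).trans (hbound.trans ?_)
    rw [EReal.coe_mul]
    exact mul_le_mul_of_nonneg_left hf.le_entropyMBGYA_uniformLaw hn'
  · refine hbound.trans (EReal.coe_le_coe_iff.2 (mul_le_mul_of_nonneg_left ?_ (by positivity)))
    have hmono := hf.monotoneOn_slope_zero hmpos hT0 hmT
    have e : ∀ t : ℝ, 0 < t → f 0 * (1 - 1 / t) + 1 / t * f t = f 0 + (f t - f 0) / t :=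
      fun t ht => by field_simp; ring
    rw [e _ hmpos, e _ hT0]
    exact add_le_add le_rfl hmono
  · intro hmeq
    rw [hf.entropyCKZ_uniformLaw, hmeq]
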